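/- Let $n\ge 2$ and $1\le p\le\infty$. Let $B^n_p=\{x\in\mathbb{R}^n:\|x\|_p\le 1\}$ be the closed unit ball of $\ell_p^n$. For a convex body $K\subset\mathbb{R}^n$ and $\delta>0$ let the convex floating body $K_\delta$ be the intersection of all closed halfspaces $\{y:\langle y,u\rangle\le t\}$ ($u\in\mathbb{R}^n$ a Euclidean unit vector, $t\in\mathbb{R}$) for which $|K\cap\{y:\langle y,u\rangle\ge t\}|\le\delta$, where $|\cdot|$ denotes Lebesgue measure. (i) Let $0<\delta<|B^n_p|/2$. Then $(B^n_p)_\delta=c\,B^n_p$ for some $0<c<1$ if and only if $p=2$. (ii) Let $T$ be an invertible linear map of $\mathbb{R}^n$, let $K=T(B^n_p)$ and let $0<\delta<|K|/2$. Then $K_\delta=c\,K$ for some $0<c<1$ if and only if $p=2$, and also if and only if $K$ is an ellipsoid (the image of $B^n_2$ under an invertible affine map). -/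

import Mathlib

open MeasureTheory
open scoped Pointwise ENNReal

noncomputable section

/-- The closed unit ball of `ℓ_p^n`, as a subset of Euclidean space `ℝⁿ`; the norm is
`(∑ |xᵢ|^p)^(1/p)` for finite `p` and `max |xᵢ|` for `p = ∞`. -/
def lpUnitBall (n : ℕ) (p : ℝ≥0∞) : Set (EuclideanSpace ℝ (Fin n)) :=
  {x | ‖(WithLp.toLp p (fun i => x i) : PiLp p (fun _ : Fin n => ℝ))‖ ≤ 1}

/-- The convex floating body `K_δ`: the intersection of all closed halfspaces
`H⁺ = {y | ⟨y, u⟩ ≤ t}` (`u` a unit vector, `t` real) such that the complementary closed halfspace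
`H⁻ = {y | t ≤ ⟨y, u⟩}` cuts off from `K` a set of volume at most `δ`. -/
def convexFloatingBody {n : ℕ} (K : Set (EuclideanSpace ℝ (Fin n))) (δ : ℝ) :
    Set (EuclideanSpace ℝ (Fin n)) :=
  ⋂ (u : EuclideanSpace ℝ (Fin n)) (t : ℝ) (_ : ‖u‖ = 1)
    (_ : volume ({y | t ≤ inner ℝ y u} ∩ K) ≤ ENNReal.ofReal δ), {y | inner ℝ y u ≤ t}

/-- An ellipsoid: the image of the Euclidean unit ball under an invertible affine map. -/
def IsEllipsoid {n : ℕ} (K : Set (EuclideanSpace ℝ (Fin n))) : Prop :=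
  ∃ A : EuclideanSpace ℝ (Fin n) ≃ᵃ[ℝ] EuclideanSpace ℝ (Fin n),
    K = A '' Metric.closedBall 0 1

/-- `K_δ = c K` for some `0 < c < 1`. -/
def HomotheticToFloatingBody {n : ℕ} (K : Set (EuclideanSpace ℝ (Fin n))) (δ : ℝ) : Prop :=
  ∃ c : ℝ, 0 < c ∧ c < 1 ∧ convexFloatingBody K δ = c • K

end

/-!
Write `K` for the unit ball of `ℓ_p^n` and suppose `K_δ = c K` with `0 < c < 1`. The inclusion
`c K ⊆ K_δ` says that every tangent hyperplane of `c K` cuts off at least volume `δ` from `K`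
(`lt_volume_cap`), while `K_δ ⊆ c K` says that every boundary point of `c K` has a supporting
hyperplane cutting off at most `δ` (`exists_support_volume_cap_le`). For `p ≠ 2` these two facts
contradict each other near the pole `c e₀`: there `c K` has zero curvature (`p > 2`), infinite
curvature (`1 < p < 2`) or a vertex (`p = 1`), whereas a floating body `c K` whose hyperplanes all
cut off the same volume would have finite positive curvature.

The curvature of the floating body enters through an elementary comparison of the caps
`{x₀ ≥ s}` and `{x₀ + ⟨b, x'⟩ ≥ s}`, where `x'` denotes the remaining coordinates. The reflection
`x ↦ 2 s e₀ - x` in the common point `s e₀` exchanges the two wedges between their boundary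
hyperplanes, and the caps differ in volume only by the points of one wedge that are reflected out
of `K` (`volume_cap_le_add`, `add_le_volume_cap`). These points form a layer of thickness
proportional to `|b|` in the direction `e₀` over a shell of `ℓ_p^{n-1}` of thickness proportional
to `|b|`, so their volume is of order `|b| ^ 2`; the shell is measured by homogeneity
(`volume_shell`). For `p = ∞` and small `b` there are no such points at all.

For `p > 2` the tangent hyperplane of `c K` with slope `b = 2 τ ^ (p - 1)` lies at least
`c τ ^ p` further out than the polar one, and this loss of volume exceeds the gain of order
`τ ^ (2 p - 2)` (`not_convexFloatingBody_eq_smul_of_flat`; for `p = ∞` the exponent `3` serves in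
place of `p`). For `1 ≤ p < 2` the tangent hyperplanes at `c (z, τ, …, τ)` have total slope
`S ≥ τ ^ (p - 1) / 2` and lie only `O(S τ)` further out, which is less than the gain of order
`S ^ 2` (`convexFloatingBody_lpUnitBall_ne_of_lt_two`).

For `p = 2` rotation invariance makes `K_δ` a ball, and its radius lies strictly between `0` and `1`
because caps have volume close to half of the ball at the centre and close to zero at the boundary.
Invertible linear maps commute with the formation of floating bodies up to rescaling `δ`
(`homotheticToFloatingBody_image`), and an `ℓ_p` ball is an ellipsoid only if its norm satisfies
the parallelogram law, that is, if `p = 2` (`eq_two_of_isEllipsoid`).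
-/

/-! ### Halfspaces and the floating body -/

theorem mem_convexFloatingBody_iff {n : ℕ} {K : Set (EuclideanSpace ℝ (Fin n))} {δ : ℝ}
    {x : EuclideanSpace ℝ (Fin n)} :
    x ∈ convexFloatingBody K δ ↔ ∀ (u : EuclideanSpace ℝ (Fin n)) (t : ℝ), u ≠ 0 →
      volume ({y | t ≤ inner ℝ y u} ∩ K) ≤ ENNReal.ofReal δ → inner ℝ x u ≤ t := by
  simp only [convexFloatingBody, Set.mem_iInter, Set.mem_ofPred_eq]
  constructor
  · intro h u t hu hv
    have hn : 0 < ‖u‖ := norm_pos_iff.2 hu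
    have key : ∀ y : EuclideanSpace ℝ (Fin n),
        inner ℝ y (‖u‖⁻¹ • u) = ‖u‖⁻¹ * inner ℝ y u := fun y => by
      rw [inner_smul_right]
    have h1 := h (‖u‖⁻¹ • u) (‖u‖⁻¹ * t) (by rw [norm_smul]; simp [hn.ne'])
    simp only [key, mul_le_mul_iff_right₀ (inv_pos.2 hn)] at h1
    exact h1 hv
  · intro h u t hu hv
    exact h u t (by rintro rfl; simp at hu) hv

theorem image_convexFloatingBody_subset {n : ℕ} (K : Set (EuclideanSpace ℝ (Fin n)))
    (T : EuclideanSpace ℝ (Fin n) ≃ₗ[ℝ] EuclideanSpace ℝ (Fin n)) (δ : ℝ) :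
    T '' convexFloatingBody K (δ / |LinearMap.det (T : EuclideanSpace ℝ (Fin n) →ₗ[ℝ] _)|) ⊆
      convexFloatingBody (T '' K) δ := by
  set d := LinearMap.det (T : EuclideanSpace ℝ (Fin n) →ₗ[ℝ] EuclideanSpace ℝ (Fin n)) with hd
  have hd0 : 0 < |d| := abs_pos.2 (LinearEquiv.isUnit_det' T).ne_zero
  rintro _ ⟨x, hx, rfl⟩
  rw [mem_convexFloatingBody_iff] at hx ⊢
  intro u t hu hv
  set T' := LinearMap.adjoint (T : EuclideanSpace ℝ (Fin n) →ₗ[ℝ] EuclideanSpace ℝ (Fin n))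
  have hT : ∀ y, inner ℝ y (T' u) = inner ℝ (T y) u := fun y =>
    LinearMap.adjoint_inner_right _ _ _
  rw [← hT]
  refine hx (T' u) t ?_ ?_
  · intro h0
    have h1 := hT (T.symm u)
    rw [h0] at h1
    simp only [inner_zero_right, LinearEquiv.apply_symm_apply] at h1
    exact hu (inner_self_eq_zero.1 h1.symm)
  · have hset : {y | t ≤ inner ℝ y u} ∩ T '' K =
        (T : EuclideanSpace ℝ (Fin n) →ₗ[ℝ] _) '' ({y | t ≤ inner ℝ y (T' u)} ∩ K) := by
      ext y
      constructor
      · rintro ⟨hy, z, hz, rfl⟩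
        exact ⟨z, ⟨by simpa [hT] using hy, hz⟩, rfl⟩
      · rintro ⟨z, ⟨hz, hzK⟩, rfl⟩
        exact ⟨by simpa [hT] using hz, z, hzK, rfl⟩
    rw [hset, Measure.addHaar_image_linearMap, ← hd] at hv
    rw [ENNReal.ofReal_div_of_pos hd0, ENNReal.le_div_iff_mul_le
      (Or.inl (ENNReal.ofReal_pos.2 hd0).ne')
      (Or.inl ENNReal.ofReal_ne_top),
      mul_comm]
    exact hv

/-- Linear maps commute with the formation of floating bodies, up to rescaling the volume. -/
theorem convexFloatingBody_image {n : ℕ} (K : Set (EuclideanSpace ℝ (Fin n)))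
    (T : EuclideanSpace ℝ (Fin n) ≃ₗ[ℝ] EuclideanSpace ℝ (Fin n)) (δ : ℝ) :
    convexFloatingBody (T '' K) δ =
      T '' convexFloatingBody K (δ / |LinearMap.det (T : EuclideanSpace ℝ (Fin n) →ₗ[ℝ] _)|) := by
  refine subset_antisymm ?_ (image_convexFloatingBody_subset K T δ)
  have hd0 : |LinearMap.det (T : EuclideanSpace ℝ (Fin n) →ₗ[ℝ] EuclideanSpace ℝ (Fin n))| ≠ 0 :=
    (abs_pos.2 (LinearEquiv.isUnit_det' T).ne_zero).ne'
  have h := image_convexFloatingBody_subset (T '' K) T.symm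
    (δ / |LinearMap.det (T : EuclideanSpace ℝ (Fin n) →ₗ[ℝ] EuclideanSpace ℝ (Fin n))|)
  rw [LinearEquiv.det_coe_symm, abs_inv, div_inv_eq_mul, div_mul_cancel₀ _ hd0,
    Set.image_image] at h
  simp only [LinearEquiv.symm_apply_apply, Set.image_id'] at h
  intro x hx
  exact ⟨T.symm x, h ⟨x, hx, rfl⟩, T.apply_symm_apply x⟩

theorem homotheticToFloatingBody_image {n : ℕ} (K : Set (EuclideanSpace ℝ (Fin n)))
    (T : EuclideanSpace ℝ (Fin n) ≃ₗ[ℝ] EuclideanSpace ℝ (Fin n)) (δ : ℝ) :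
    HomotheticToFloatingBody (T '' K) δ ↔ HomotheticToFloatingBody K
      (δ / |LinearMap.det (T : EuclideanSpace ℝ (Fin n) →ₗ[ℝ] EuclideanSpace ℝ (Fin n))|) := by
  unfold HomotheticToFloatingBody
  have h : ∀ c : ℝ, T '' (c • K) = c • T '' K := fun c =>
    Set.image_smul_comm T c K fun x => map_smul T c x
  simp only [convexFloatingBody_image, ← h, T.injective.image_injective.eq_iff]

/-- Otherwise the halfspace `{y | ⟨y, u⟩ ≤ t}` would take part in the intersection defining the
floating body and exclude `c • z`. -/
theorem lt_volume_cap {n : ℕ} {K : Set (EuclideanSpace ℝ (Fin n))} {δ c : ℝ}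
    (h : c • K ⊆ convexFloatingBody K δ) {u z : EuclideanSpace ℝ (Fin n)} (hu : u ≠ 0)
    (hz : z ∈ K) {t : ℝ} (ht : t < c * inner ℝ z u) :
    ENNReal.ofReal δ < volume ({y | t ≤ inner ℝ y u} ∩ K) := by
  by_contra! hv
  have := mem_convexFloatingBody_iff.1 (h (Set.smul_mem_smul_set hz)) u t hu hv
  rw [real_inner_smul_left] at this
  linarith

/-- At a boundary point `c • x` of a floating body `K_δ = c K`, some supporting hyperplane cuts
off volume at most `δ`: it is a limit of hyperplanes separating the points `(1 + ε) c • x` from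
`c K`. -/
theorem exists_support_volume_cap_le {n : ℕ} {K : Set (EuclideanSpace ℝ (Fin n))} {δ c : ℝ}
    (hc : 0 < c) (h : convexFloatingBody K δ = c • K)
    {x : EuclideanSpace ℝ (Fin n)} (hx : ∀ r : ℝ, 1 < r → r • x ∉ K) :
    ∃ u : EuclideanSpace ℝ (Fin n), u ≠ 0 ∧ (∀ z ∈ K, inner ℝ z u ≤ inner ℝ x u) ∧
      volume ({y | c * inner ℝ x u < inner ℝ y u} ∩ K) ≤ ENNReal.ofReal δ := by
  have hr : ∀ k : ℕ, (1 : ℝ) < 1 + 1 / ((k : ℝ) + 1) := fun k => by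
    have : (0 : ℝ) < 1 / ((k : ℝ) + 1) := by positivity
    linarith
  have hex : ∀ k : ℕ, ∃ u : EuclideanSpace ℝ (Fin n), ‖u‖ = 1 ∧
      (∀ z ∈ K, inner ℝ z u ≤ (1 + 1 / ((k : ℝ) + 1)) * inner ℝ x u) ∧
      volume ({y | c * ((1 + 1 / ((k : ℝ) + 1)) * inner ℝ x u) ≤ inner ℝ y u} ∩ K) ≤
        ENNReal.ofReal δ := by
    intro k
    have h1 : c • ((1 + 1 / ((k : ℝ) + 1)) • x) ∉ convexFloatingBody K δ := by
      rw [h, Set.smul_mem_smul_set_iff₀ hc.ne']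
      exact hx _ (hr k)
    simp only [convexFloatingBody, Set.mem_iInter, Set.mem_ofPred_eq, not_forall, not_le] at h1
    obtain ⟨u, t, hu, hv, hlt⟩ := h1
    rw [real_inner_smul_left, real_inner_smul_left] at hlt
    refine ⟨u, hu, fun z hz => ?_, (measure_mono ?_).trans hv⟩
    · have h2 : c • z ∈ convexFloatingBody K δ := h ▸ Set.smul_mem_smul_set hz
      have h3 := mem_convexFloatingBody_iff.1 h2 u t (by rintro rfl; simp at hu) hv
      rw [real_inner_smul_left] at h3
      exact le_of_mul_le_mul_left (h3.trans hlt.le) hc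
    · exact Set.inter_subset_inter_left _ fun y hy => hlt.le.trans hy
  choose u hu1 hu2 hu3 using hex
  obtain ⟨w, hw, φ, hφ, hlim⟩ := (isCompact_sphere (0 : EuclideanSpace ℝ (Fin n)) 1).tendsto_subseq
    (x := u) (fun k => by simp [hu1])
  have hseq : Filter.Tendsto (fun k => (1 + 1 / ((φ k : ℝ) + 1))) Filter.atTop (nhds 1) := by
    have := (tendsto_one_div_add_atTop_nhds_zero_nat (𝕜 := ℝ)).comp hφ.tendsto_atTop
    simpa using this.const_add 1
  have hin : ∀ y : EuclideanSpace ℝ (Fin n), Filter.Tendsto (fun k => inner ℝ y (u (φ k)))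
      Filter.atTop (nhds (inner ℝ y w)) := fun y => tendsto_const_nhds.inner hlim
  have hprod : Filter.Tendsto (fun k => (1 + 1 / ((φ k : ℝ) + 1)) * inner ℝ x (u (φ k)))
      Filter.atTop (nhds (inner ℝ x w)) := by simpa using hseq.mul (hin x)
  refine ⟨w, ?_, fun z hz => ?_, ?_⟩
  · rintro rfl
    simp at hw
  · exact le_of_tendsto_of_tendsto' (hin z) hprod fun k => hu2 _ z hz
  · set S : ℕ → Set (EuclideanSpace ℝ (Fin n)) := fun k =>
      {y | c * ((1 + 1 / ((φ k : ℝ) + 1)) * inner ℝ x (u (φ k))) ≤ inner ℝ y (u (φ k))} ∩ K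
    -- every point of the open limit cap lies in all but finitely many of the approximating caps
    have hsub : {y | c * inner ℝ x w < inner ℝ y w} ∩ K ⊆ ⋃ N, ⋂ k ≥ N, S k := by
      rintro y ⟨hy, hyK⟩
      have hev := (hprod.const_mul c).eventually_lt (hin y) hy
      obtain ⟨N, hN⟩ := Filter.eventually_atTop.1 hev
      exact Set.mem_iUnion.2 ⟨N, Set.mem_iInter₂.2 fun k hk => ⟨(hN k hk).le, hyK⟩⟩
    refine (measure_mono hsub).trans ?_
    rw [Monotone.measure_iUnion]
    · refine iSup_le fun N => ?_
      exact (measure_mono (Set.iInter₂_subset N le_rfl)).trans (hu3 _)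
    · intro N M hNM
      exact Set.biInter_mono (fun k hk => le_trans hNM hk) fun _ _ => le_rfl

/-! ### Comparing two caps by reflection in a point -/

/-- Reflection in a common point of the two hyperplanes sends the part of one cap missing from the
other back into `K`, except on the set in the last summand. -/
theorem volume_cap_le_add {n : ℕ} {K : Set (EuclideanSpace ℝ (Fin n))} (hK : MeasurableSet K)
    {a u v : EuclideanSpace ℝ (Fin n)} {s : ℝ} (hau : inner ℝ a u = s) (hav : inner ℝ a v = s) :
    volume ({y | s < inner ℝ y u} ∩ K) ≤ volume ({y | s ≤ inner ℝ y v} ∩ K) +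
      volume {y | y ∈ K ∧ inner ℝ y v < s ∧ s < inner ℝ y u ∧ (2 : ℝ) • a - y ∉ K} := by
  set A := {y | s < inner ℝ y u} ∩ K
  set B := {y | s ≤ inner ℝ y v} ∩ K
  have hA : MeasurableSet A := (measurableSet_lt (by fun_prop) (by fun_prop)).inter hK
  have hB : MeasurableSet B := (measurableSet_le (by fun_prop) (by fun_prop)).inter hK
  set G := {y | y ∈ K ∧ inner ℝ y v < s ∧ s < inner ℝ y u ∧ (2 : ℝ) • a - y ∉ K}
  have h1 : A \ B ⊆ ((fun y => (2 : ℝ) • a - y) ⁻¹' (B \ A)) ∪ G := by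
    rintro y ⟨⟨hyu, hyK⟩, hyB⟩
    have hyv : inner ℝ y v < s := by
      by_contra! hh
      exact hyB ⟨hh, hyK⟩
    by_cases hR : (2 : ℝ) • a - y ∈ K
    · left
      refine ⟨⟨?_, hR⟩, fun hh => ?_⟩
      · simp only [Set.mem_ofPred_eq, inner_sub_left, real_inner_smul_left, hav]
        linarith
      · have := hh.1
        simp only [Set.mem_ofPred_eq, inner_sub_left, real_inner_smul_left, hau] at this hyu
        linarith
    · exact Or.inr ⟨hyK, hyv, hyu, hR⟩
  have h2 : volume ((fun y => (2 : ℝ) • a - y) ⁻¹' (B \ A)) = volume (B \ A) :=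
    (Measure.measurePreserving_sub_left volume ((2 : ℝ) • a)).measure_preimage
      (hB.diff hA).nullMeasurableSet
  calc volume A = volume (A ∩ B) + volume (A \ B) := (measure_inter_add_sdiff A hB).symm
    _ ≤ volume (A ∩ B) + (volume (B \ A) + volume G) := by
        gcongr
        exact (measure_mono h1).trans ((measure_union_le _ _).trans (by rw [h2]))
    _ = volume B + volume G := by
        rw [← add_assoc, Set.inter_comm, measure_inter_add_sdiff B hA]

/-- If reflection in `a` maps the part of `K` beyond the hyperplane orthogonal to `v` into `K`,
then the cap in direction `u` through `a` is at least as large as the one in direction `v`, and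
the points with reflection outside `K` give the excess. -/
theorem add_le_volume_cap {n : ℕ} {K : Set (EuclideanSpace ℝ (Fin n))} (hK : MeasurableSet K)
    {a u v : EuclideanSpace ℝ (Fin n)} {s : ℝ} (hau : inner ℝ a u = s) (hav : inner ℝ a v = s)
    (hfold : ∀ y ∈ K, s < inner ℝ y v → (2 : ℝ) • a - y ∈ K) :
    volume ({y | s < inner ℝ y v} ∩ K) +
      volume {y | y ∈ K ∧ inner ℝ y v ≤ s ∧ s ≤ inner ℝ y u ∧ (2 : ℝ) • a - y ∉ K} ≤
    volume ({y | s ≤ inner ℝ y u} ∩ K) := by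
  set A := {y | s ≤ inner ℝ y u} ∩ K
  set B := {y | s < inner ℝ y v} ∩ K
  have hA : MeasurableSet A := (measurableSet_le (by fun_prop) (by fun_prop)).inter hK
  have hB : MeasurableSet B := (measurableSet_lt (by fun_prop) (by fun_prop)).inter hK
  set G := {y | y ∈ K ∧ inner ℝ y v ≤ s ∧ s ≤ inner ℝ y u ∧ (2 : ℝ) • a - y ∉ K}
  have hm := Measure.measurePreserving_sub_left
    (volume : Measure (EuclideanSpace ℝ (Fin n))) ((2 : ℝ) • a)
  set R := (fun y => (2 : ℝ) • a - y) ⁻¹' (B \ A)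
  have hR : MeasurableSet R := hm.measurable (hB.diff hA)
  have h1 : R ∪ G ⊆ A \ B := by
    rintro y (⟨⟨hyv, hyK⟩, hyA⟩ | ⟨hyK, hyv, hyu, -⟩)
    · have hyu : inner ℝ ((2 : ℝ) • a - y) u < s := by
        by_contra! hh
        exact hyA ⟨hh, hyK⟩
      have hyK' : y ∈ K := by simpa using hfold _ hyK hyv
      simp only [Set.mem_ofPred_eq, inner_sub_left, real_inner_smul_left, hau, hav] at hyv hyu
      exact ⟨⟨show s ≤ inner ℝ y u by linarith, hyK'⟩, fun hh => by
        have := hh.1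
        simp only [Set.mem_ofPred_eq] at this
        linarith⟩
    · exact ⟨⟨hyu, hyK⟩, fun hh => absurd hh.1 (not_lt.2 hyv)⟩
  have hdisj : Disjoint R G := by
    rw [Set.disjoint_left]
    rintro y ⟨⟨-, hyK⟩, -⟩ ⟨-, -, -, hyK'⟩
    exact hyK' hyK
  have h2 : volume R = volume (B \ A) := hm.measure_preimage (hB.diff hA).nullMeasurableSet
  calc volume B + volume G = volume (B ∩ A) + (volume R + volume G) := by
        rw [h2, ← add_assoc, measure_inter_add_sdiff B hA]
    _ ≤ volume (A ∩ B) + volume (A \ B) := by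
        rw [Set.inter_comm, ← measure_union' hdisj hR]
        gcongr
    _ = volume A := measure_inter_add_sdiff A hB

/-! ### Coordinates, boxes and shells -/

/-- The vector of `ℝ^(m+1)` with first coordinate `a` and remaining coordinates `y`. -/
def consVec {m : ℕ} (a : ℝ) (y : Fin m → ℝ) : EuclideanSpace ℝ (Fin (m + 1)) :=
  WithLp.toLp 2 (Fin.cons a y : Fin (m + 1) → ℝ)

@[simp] theorem consVec_zero {m : ℕ} (a : ℝ) (y : Fin m → ℝ) : consVec a y 0 = a := rfl

@[simp] theorem consVec_succ {m : ℕ} (a : ℝ) (y : Fin m → ℝ) (i : Fin m) :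
    consVec a y i.succ = y i := rfl

theorem inner_eq_add_sum {m : ℕ} (x u : EuclideanSpace ℝ (Fin (m + 1))) :
    inner ℝ x u = x 0 * u 0 + ∑ i : Fin m, x i.succ * u i.succ := by
  simp [PiLp.inner_apply, Fin.sum_univ_succ, mul_comm]

theorem volume_setOf_head_mem_tail_mem {m : ℕ} (I : Set ℝ) (Y : Set (Fin m → ℝ)) :
    volume {x : EuclideanSpace ℝ (Fin (m + 1)) | x 0 ∈ I ∧ (fun i : Fin m => x i.succ) ∈ Y} =
      volume I * volume Y := by
  have h1 := (EuclideanSpace.volume_preserving_symm_measurableEquiv_toLp (Fin (m + 1)))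
  have h2 := volume_preserving_piFinSuccAbove (fun _ : Fin (m + 1) => ℝ) 0
  rw [← Measure.prod_prod, ← Measure.volume_eq_prod, ← h2.measure_preimage_equiv,
    ← h1.measure_preimage_equiv]
  rfl

theorem volume_setOf_head_mem_Icc {m : ℕ} (a b : ℝ) {η : ℝ} (hη : 0 ≤ η) :
    volume {x : EuclideanSpace ℝ (Fin (m + 1)) | x 0 ∈ Set.Icc a b ∧ ∀ i : Fin m, |x i.succ| ≤ η} =
      ENNReal.ofReal ((b - a) * (2 * η) ^ m) := by
  have h := volume_setOf_head_mem_tail_mem (Set.Icc a b) (Set.Icc (fun _ : Fin m => -η) fun _ => η)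
  have hs : {x : EuclideanSpace ℝ (Fin (m + 1)) | x 0 ∈ Set.Icc a b ∧ ∀ i : Fin m, |x i.succ| ≤ η} =
      {x | x 0 ∈ Set.Icc a b ∧
        (fun i : Fin m => x i.succ) ∈ Set.Icc (fun _ : Fin m => -η) fun _ => η} := by
    ext x
    simp only [Set.mem_ofPred_eq, Set.mem_Icc, Pi.le_def, abs_le, forall_and]
  rw [hs, h, Real.volume_Icc, Real.volume_Icc_pi, mul_comm (b - a),
    ENNReal.ofReal_mul (by positivity), mul_comm, ENNReal.ofReal_pow (by positivity)]
  simp [two_mul]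

theorem volume_cone_inter {m : ℕ} {p : ℝ} (hp : 1 ≤ p) {Q : Set (Fin m → ℝ)}
    (hQ : ∀ r : ℝ, 0 < r → ∀ y ∈ Q, r • y ∈ Q) {a : ℝ} (ha : 0 < a) :
    volume (Q ∩ {y | ∑ i, |y i| ^ p ≤ a}) =
      ENNReal.ofReal (a ^ ((m : ℝ) / p)) * volume (Q ∩ {y | ∑ i, |y i| ^ p ≤ 1}) := by
  have hp0 : p ≠ 0 := by positivity
  set ρ := a ^ (1 / p) with hρ
  have hρ0 : 0 < ρ := by positivity
  have hρp : ρ ^ p = a := by rw [hρ, ← Real.rpow_mul ha.le]; field_simp; simp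
  have hρm : ρ ^ m = a ^ ((m : ℝ) / p) := by
    rw [hρ, ← Real.rpow_natCast, ← Real.rpow_mul ha.le]
    congr 1
    field_simp
  have hset : Q ∩ {y | ∑ i, |y i| ^ p ≤ a} = ρ • (Q ∩ {y | ∑ i, |y i| ^ p ≤ 1}) := by
    have hsum : ∀ (c : ℝ) (y : Fin m → ℝ), 0 < c →
        ∑ i, |(c • y) i| ^ p = c ^ p * ∑ i, |y i| ^ p := fun c y hc => by
      rw [Finset.mul_sum]
      refine Finset.sum_congr rfl fun i _ => ?_
      rw [Pi.smul_apply, smul_eq_mul, abs_mul, abs_of_pos hc, Real.mul_rpow hc.le (abs_nonneg _)]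
    ext y
    rw [Set.mem_smul_set_iff_inv_smul_mem₀ hρ0.ne']
    simp only [Set.mem_inter_iff, Set.mem_ofPred_eq, hsum _ _ (inv_pos.2 hρ0),
      Real.inv_rpow hρ0.le, hρp]
    rw [inv_mul_le_iff₀ ha, mul_one]
    refine and_congr_left fun _ => ⟨fun h => hQ _ (inv_pos.2 hρ0) _ h, fun h => ?_⟩
    simpa [smul_smul, hρ0.ne'] using hQ ρ hρ0 _ h
  rw [hset, Measure.addHaar_smul, Module.finrank_fin_fun, hρm, abs_of_nonneg (by positivity)]

theorem volume_sum_rpow_le_one_lt_top {m : ℕ} {p : ℝ} (hp : 1 ≤ p) (Q : Set (Fin m → ℝ)) :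
    volume (Q ∩ {y : Fin m → ℝ | ∑ i, |y i| ^ p ≤ 1}) < ⊤ := by
  refine (measure_mono ?_).trans_lt
    (isCompact_Icc (a := fun _ : Fin m => (-1 : ℝ)) (b := fun _ => 1)).measure_lt_top
  rintro y ⟨-, hy⟩
  rw [Set.mem_ofPred_eq] at hy
  have h1 : ∀ i, |y i| ≤ 1 := fun i => by
    by_contra! hh
    have h2 := Real.one_lt_rpow hh (by linarith : 0 < p)
    have h3 := Finset.single_le_sum (f := fun i => |y i| ^ p) (fun i _ => by positivity)
      (Finset.mem_univ i)
    linarith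
  exact ⟨fun i => (abs_le.1 (h1 i)).1, fun i => (abs_le.1 (h1 i)).2⟩

/-- The volume of the part of a cone `Q` between two `ℓ_p`-spheres, by homogeneity. -/
theorem volume_shell {m : ℕ} {p : ℝ} (hp : 1 ≤ p) {Q : Set (Fin m → ℝ)} (hQm : MeasurableSet Q)
    (hQ : ∀ r : ℝ, 0 < r → ∀ y ∈ Q, r • y ∈ Q) {s t : ℝ} (hs : 0 < s) (hst : s ≤ t) (ht : t < 1) :
    volume (Q ∩ {y | 1 - t ^ p < ∑ i, |y i| ^ p ∧ ∑ i, |y i| ^ p ≤ 1 - s ^ p}) =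
      ENNReal.ofReal (((1 - s ^ p) ^ ((m : ℝ) / p) - (1 - t ^ p) ^ ((m : ℝ) / p)) *
        (volume (Q ∩ {y | ∑ i, |y i| ^ p ≤ 1})).toReal) := by
  have hp0 : 0 < p := by linarith
  have ht' : 0 < 1 - t ^ p := by
    have := Real.rpow_lt_one (by linarith) ht hp0
    linarith
  have hst' : s ^ p ≤ t ^ p := Real.rpow_le_rpow hs.le hst hp0.le
  have hset : Q ∩ {y | 1 - t ^ p < ∑ i, |y i| ^ p ∧ ∑ i, |y i| ^ p ≤ 1 - s ^ p} =
      (Q ∩ {y | ∑ i, |y i| ^ p ≤ 1 - s ^ p}) \ (Q ∩ {y | ∑ i, |y i| ^ p ≤ 1 - t ^ p}) := by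
    ext y
    simp only [Set.mem_inter_iff, Set.mem_ofPred_eq, Set.mem_sdiff, not_and, not_le]
    tauto
  have hV := volume_sum_rpow_le_one_lt_top hp Q
  have hmeas : MeasurableSet (Q ∩ {y | ∑ i, |y i| ^ p ≤ 1 - t ^ p}) :=
    hQm.inter (measurableSet_le (by fun_prop) (by fun_prop))
  rw [hset, measure_sdiff _ hmeas.nullMeasurableSet, volume_cone_inter hp hQ ht',
    volume_cone_inter hp hQ (by linarith : 0 < 1 - s ^ p), ENNReal.ofReal_mul,
    ENNReal.ofReal_toReal hV.ne, ENNReal.ofReal_sub, ENNReal.sub_mul]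
  · exact fun _ _ => hV.ne
  · positivity
  · rw [sub_nonneg]
    exact Real.rpow_le_rpow ht'.le (by linarith) (by positivity)
  · rw [volume_cone_inter hp hQ ht']
    exact ENNReal.mul_ne_top ENNReal.ofReal_ne_top hV.ne
  · rintro y ⟨hy, hy'⟩
    exact ⟨hy, le_trans hy' (sub_le_sub_left hst' 1)⟩

/-- On compact subintervals of `(0, 1)` the function `s ↦ (1 - s ^ p) ^ e` is decreasing at a rate
bounded above and below. -/
theorem exists_bounds_one_sub_rpow {p e a b : ℝ} (hp : 1 ≤ p) (he : 0 < e) (ha : 0 < a)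
    (hab : a ≤ b) (hb : b < 1) :
    ∃ C₁ C₂ : ℝ, 0 < C₁ ∧ 0 < C₂ ∧ ∀ s t, a ≤ s → s ≤ t → t ≤ b →
      C₁ * (t - s) ≤ (1 - s ^ p) ^ e - (1 - t ^ p) ^ e ∧
      (1 - s ^ p) ^ e - (1 - t ^ p) ^ e ≤ C₂ * (t - s) := by
  have hp0 : 0 < p := by linarith
  have hpos : ∀ s ∈ Set.Icc a b, 0 < s ∧ 0 < 1 - s ^ p := fun s hs => by
    have h0 : 0 < s := ha.trans_le hs.1
    have := Real.rpow_lt_one h0.le (hs.2.trans_lt hb) hp0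
    exact ⟨h0, by linarith⟩
  set f' : ℝ → ℝ := fun s => (p * s ^ (p - 1)) * e * (1 - s ^ p) ^ (e - 1) with hf'
  have hf'pos : ∀ s ∈ Set.Icc a b, 0 < f' s := fun s hs => by
    obtain ⟨h1, h2⟩ := hpos s hs
    simp only [hf']
    positivity
  have hderiv : ∀ s ∈ Set.Icc a b, HasDerivAt (fun s : ℝ => -(1 - s ^ p) ^ e) (f' s) s :=
    fun s hs => by
    obtain ⟨h1, h2⟩ := hpos s hs
    have := (((Real.hasDerivAt_rpow_const (p := p) (Or.inl h1.ne')).const_sub 1).rpow_const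
      (p := e) (Or.inl h2.ne')).neg
    exact this.congr_deriv (by simp only [hf']; ring)
  have hcont : ContinuousOn f' (Set.Icc a b) := fun s hs => by
    obtain ⟨h1, h2⟩ := hpos s hs
    have hc1 : ContinuousAt (fun s : ℝ => s ^ (p - 1)) s :=
      Real.continuousAt_rpow_const _ _ (Or.inl h1.ne')
    have hc2 : ContinuousAt (fun s : ℝ => (1 - s ^ p) ^ (e - 1)) s :=
      (continuousAt_const.sub (Real.continuousAt_rpow_const _ _ (Or.inl h1.ne'))).rpow_const
        (Or.inl h2.ne')
    exact (((continuousAt_const.mul hc1).mul continuousAt_const).mul hc2).continuousWithinAt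
  obtain ⟨x₁, hx₁, hmin⟩ := isCompact_Icc.exists_isMinOn (Set.nonempty_Icc.2 hab) hcont
  obtain ⟨x₂, hx₂, hmax⟩ := isCompact_Icc.exists_isMaxOn (Set.nonempty_Icc.2 hab) hcont
  refine ⟨f' x₁, f' x₂, hf'pos _ hx₁, hf'pos _ hx₂, fun s t hs hst ht => ?_⟩
  rcases hst.eq_or_lt with rfl | hlt
  · simp
  have hsub : ∀ x ∈ Set.Icc s t, x ∈ Set.Icc a b := fun x hx => ⟨hs.trans hx.1, hx.2.trans ht⟩
  obtain ⟨x, hx, hslope⟩ := exists_hasDerivAt_eq_slope (fun s : ℝ => -(1 - s ^ p) ^ e) f' hlt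
    (fun x hx => (hderiv x (hsub x hx)).continuousAt.continuousWithinAt)
    (fun x hx => hderiv x (hsub x ⟨hx.1.le, hx.2.le⟩))
  have hxI := hsub x ⟨hx.1.le, hx.2.le⟩
  have h1 : f' x₁ ≤ f' x := hmin hxI
  have h2 : f' x ≤ f' x₂ := hmax hxI
  have hts : 0 < t - s := by linarith
  have h3 : (1 - s ^ p) ^ e - (1 - t ^ p) ^ e = f' x * (t - s) := by
    rw [hslope]
    field_simp
    ring
  rw [h3]
  exact ⟨by gcongr, by gcongr⟩

theorem exists_small_rpow_lt {e ε₁ ε₂ : ℝ} (he : 0 < e) (h₁ : 0 < ε₁) (h₂ : 0 < ε₂) :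
    ∃ τ : ℝ, 0 < τ ∧ τ < ε₁ ∧ τ ^ e < ε₂ := by
  have h : Filter.Tendsto (fun τ : ℝ => τ ^ e) (nhdsWithin 0 (Set.Ioi 0)) (nhds 0) := by
    have := (Real.continuousAt_rpow_const 0 e (Or.inr he.le)).tendsto
    rw [Real.zero_rpow he.ne'] at this
    exact this.mono_left nhdsWithin_le_nhds
  obtain ⟨τ, h3, h4⟩ := ((h.eventually_lt_const h₂).and (Ioo_mem_nhdsGT h₁)).exists
  exact ⟨τ, h4.1, h4.2, h3⟩

/-! ### Bodies that are flatter than a ball at a coordinate pole -/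

/-- At a pole `e₀` with a unique supporting hyperplane, the polar cap cut off by the tangent
hyperplane `x₀ = c` of `K_δ = c K` has volume at most `δ`. -/
theorem volume_polar_cap_le_of_flat {m : ℕ} (hm : 1 ≤ m)
    {K : Set (EuclideanSpace ℝ (Fin (m + 1)))} {r δ c : ℝ} (hr : 2 < r) (hc0 : 0 < c)
    (hpole : ∀ τ : ℝ, |τ| ≤ 1 → ∀ i : Fin m, consVec (1 - |τ| ^ r) (Pi.single i τ) ∈ K)
    (hbox : ∀ x ∈ K, ∀ i, |x i| ≤ 1) (h : convexFloatingBody K δ = c • K) :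
    volume ({y | c < y 0} ∩ K) ≤ ENNReal.ofReal δ := by
  let i₀ : Fin m := ⟨0, hm⟩
  have hr0 : (0 : ℝ) < r := by linarith
  have he₀ : consVec 1 0 ∈ K := by
    have := hpole 0 (by simp) i₀
    simpa [hr0.ne'] using this
  have hout : ∀ ρ : ℝ, 1 < ρ → ρ • consVec (m := m) 1 0 ∉ K := fun ρ hρ hmem => by
    have h1 := hbox _ hmem 0
    simp only [PiLp.smul_apply, consVec_zero, smul_eq_mul, mul_one] at h1
    linarith [le_abs_self ρ]
  obtain ⟨u, hu0, husup, huvol⟩ := exists_support_volume_cap_le hc0 h hout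
  have hineq : ∀ τ : ℝ, |τ| ≤ 1 → ∀ i : Fin m, τ * u i.succ ≤ |τ| ^ r * u 0 := fun τ hτ i => by
    have h1 := husup _ (hpole τ hτ i)
    simp only [inner_eq_add_sum, consVec_zero, consVec_succ, Pi.single_apply, ite_mul, zero_mul,
      Finset.sum_ite_eq', Finset.mem_univ, if_true, Pi.zero_apply, Finset.sum_const_zero] at h1
    linarith
  have hineq' : ∀ τ : ℝ, 0 < τ → τ ≤ 1 → ∀ i : Fin m, |u i.succ| ≤ τ ^ (r - 1) * u 0 :=
    fun τ hτ hτ1 i => by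
    have e : τ ^ r = τ * τ ^ (r - 1) := by
      rw [Real.rpow_sub_one hτ.ne']
      field_simp
    have h1 := hineq τ (by rwa [abs_of_pos hτ]) i
    have h2 := hineq (-τ) (by rwa [abs_neg, abs_of_pos hτ]) i
    rw [abs_neg] at h2
    rw [abs_of_pos hτ, e, mul_assoc] at h1 h2
    rw [abs_le]
    exact ⟨by nlinarith, by nlinarith⟩
  have hu0nn : 0 ≤ u 0 := by
    have := hineq' 1 one_pos le_rfl i₀
    rw [Real.one_rpow, one_mul] at this
    exact (abs_nonneg _).trans this
  -- letting `τ → 0` shows that the supporting hyperplane at the pole is unique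
  have husucc : ∀ i : Fin m, u i.succ = 0 := fun i => by
    by_contra hne
    have hpos : 0 < |u i.succ| := abs_pos.2 hne
    obtain ⟨τ, h1, h2, h3⟩ := exists_small_rpow_lt (e := r - 1) (ε₁ := 1)
      (ε₂ := |u i.succ| / (u 0 + 1)) (by linarith) one_pos (by positivity)
    have h4 := hineq' τ h1 h2.le i
    have h5 : τ ^ (r - 1) * (u 0 + 1) < |u i.succ| := by rwa [lt_div_iff₀ (by linarith)] at h3
    have h6 : 0 < τ ^ (r - 1) := by positivity
    nlinarith
  have hu0pos : 0 < u 0 := by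
    refine hu0nn.lt_of_ne fun h0 => hu0 ?_
    ext i
    refine Fin.cases ?_ (fun j => ?_) i
    · exact h0.symm
    · exact husucc j
  convert huvol using 3
  ext y
  simp only [inner_eq_add_sum, husucc, consVec_zero, Set.mem_ofPred_eq, mul_zero,
    Finset.sum_const_zero, add_zero, one_mul]
  rw [mul_lt_mul_iff_left₀ hu0pos]

/-- A body whose boundary leaves the tangent plane at the pole `e₀` to order `r > 2` is not
homothetic to a floating body. Tilting the hyperplane `x₀ = c` to a tangent hyperplane of `c K` with
slope `2 τ ^ (r - 1)` pushes it outwards by at least `c τ ^ r`, while the reflection argument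
changes the cap only by `O(τ ^ (2 r - 2))`. -/
theorem not_convexFloatingBody_eq_smul_of_flat {m : ℕ} (hm : 1 ≤ m)
    {K : Set (EuclideanSpace ℝ (Fin (m + 1)))} (hK : MeasurableSet K) {r δ c η C : ℝ} (hr : 2 < r)
    (hc0 : 0 < c) (hc1 : c < 1)
    (hpole : ∀ τ : ℝ, |τ| ≤ 1 → ∀ i : Fin m, consVec (1 - |τ| ^ r) (Pi.single i τ) ∈ K)
    (hbox : ∀ x ∈ K, ∀ i, |x i| ≤ 1) (hη : 0 < η)
    (hinner : ∀ x : EuclideanSpace ℝ (Fin (m + 1)), |x 0| ≤ (1 + c) / 2 →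
      (∀ i : Fin m, |x i.succ| ≤ η) → x ∈ K) {β₀ : ℝ} (hβ₀ : 0 < β₀)
    (hgain : ∀ s β : ℝ, c ≤ s → s ≤ (1 + c) / 2 → 0 < β → β ≤ β₀ →
      volume {x | x ∈ K ∧ s - β ≤ x 0 ∧ x 0 ≤ s ∧ (2 : ℝ) • consVec s 0 - x ∉ K} ≤
        ENNReal.ofReal (C * β ^ 2)) :
    convexFloatingBody K δ ≠ c • K := by
  intro h
  let i₀ : Fin m := ⟨0, hm⟩
  have hpolevol := volume_polar_cap_le_of_flat hm hr hc0 hpole hbox h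
  have hη' : 0 < (2 * η) ^ m := by positivity
  obtain ⟨τ, hτ0, hτ1, hτ2⟩ := exists_small_rpow_lt (e := r - 2)
    (ε₁ := min (min 1 (1 - c)) (β₀ / 2)) (ε₂ := c * (2 * η) ^ m / (16 * (|C| + 1))) (by linarith)
    (lt_min (lt_min one_pos (by linarith)) (by linarith)) (by positivity)
  obtain ⟨⟨hτ1, hτc⟩, hτβ⟩ : (τ < 1 ∧ τ < 1 - c) ∧ τ < β₀ / 2 := by
    simpa only [lt_min_iff] using hτ1
  have hτr : τ ^ r ≤ τ := by
    simpa using Real.rpow_le_rpow_of_exponent_ge hτ0 hτ1.le (by linarith : 1 ≤ r)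
  have hτr' : τ ^ (r - 1) ≤ τ := by
    simpa using Real.rpow_le_rpow_of_exponent_ge hτ0 hτ1.le (by linarith : 1 ≤ r - 1)
  have hr_pos : 0 < τ ^ r := by positivity
  have hr1_pos : 0 < τ ^ (r - 1) := by positivity
  have e1 : τ * τ ^ (r - 1) = τ ^ r := by
    rw [Real.rpow_sub_one hτ0.ne']
    field_simp
  have e2 : (τ ^ (r - 1)) ^ 2 = τ ^ r * τ ^ (r - 2) := by
    rw [← Real.rpow_natCast, ← Real.rpow_mul hτ0.le, ← Real.rpow_add hτ0]
    congr 1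
    push_cast
    ring
  -- with this slope `β`, the support function at `e₀ + β e₁` is at least
  -- `(1 - τ ^ r) + β τ = 1 + τ ^ r`; half of the excess is kept as a margin in `s`
  set β := 2 * τ ^ (r - 1) with hβ
  set s := c * (1 + τ ^ r / 2) with hs
  have hcs : c ≤ s := by rw [hs]; nlinarith
  have hs1 : s ≤ (1 + c) / 2 := by rw [hs]; nlinarith
  have hs0 : 0 < s := hc0.trans_le hcs
  set v : EuclideanSpace ℝ (Fin (m + 1)) := consVec 1 (Pi.single i₀ β) with hv
  set w : EuclideanSpace ℝ (Fin (m + 1)) := consVec 1 0 with hw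
  have hyv : ∀ y : EuclideanSpace ℝ (Fin (m + 1)), inner ℝ y v = y 0 + y i₀.succ * β := fun y => by
    simp [inner_eq_add_sum, hv, Pi.single_apply]
  have hyw : ∀ y : EuclideanSpace ℝ (Fin (m + 1)), inner ℝ y w = y 0 := fun y => by
    simp [inner_eq_add_sum, hw]
  have hv0 : v ≠ 0 := fun hh => by
    have := congrArg (fun x : EuclideanSpace ℝ (Fin (m + 1)) => x 0) hh
    simp [hv] at this
  have hlow : ENNReal.ofReal δ < volume ({y | s < inner ℝ y v} ∩ K) := by
    have h1 : inner ℝ (consVec (1 - |τ| ^ r) (Pi.single i₀ τ)) v = 1 + τ ^ r := by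
      rw [hyv, consVec_zero, consVec_succ, Pi.single_eq_same, abs_of_pos hτ0, hβ]
      linarith
    refine (lt_volume_cap h.ge hv0 (hpole τ (by rw [abs_of_pos hτ0]; exact hτ1.le) i₀)
      (t := c * (1 + 3 * τ ^ r / 4)) (by rw [h1]; nlinarith)).trans_le (measure_mono ?_)
    refine Set.inter_subset_inter_left _ fun y hy => ?_
    rw [Set.mem_ofPred_eq] at hy ⊢
    rw [hs]
    nlinarith
  have hup := volume_cap_le_add hK (a := consVec s 0) (u := v) (v := w) (s := s)
    (by rw [hyv]; simp) (by rw [hyw]; simp)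
  have hG : volume {y | y ∈ K ∧ inner ℝ y w < s ∧ s < inner ℝ y v ∧
      (2 : ℝ) • consVec s 0 - y ∉ K} ≤ ENNReal.ofReal (C * β ^ 2) := by
    refine (measure_mono ?_).trans (hgain s β hcs hs1 (by positivity) (by linarith))
    rintro y ⟨hyK, h1, h2, h3⟩
    rw [hyw] at h1
    rw [hyv] at h2
    have h4 := (abs_le.1 (hbox y hyK i₀.succ)).2
    have hβ0 : 0 < β := by positivity
    exact ⟨hyK, by nlinarith, h1.le, h3⟩
  have hslab : volume ({y | s ≤ inner ℝ y w} ∩ K) +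
      ENNReal.ofReal ((c * τ ^ r / 4) * (2 * η) ^ m) ≤ ENNReal.ofReal δ := by
    have e3 : c * τ ^ r / 4 = c * (1 + 3 * τ ^ r / 8) - c * (1 + τ ^ r / 8) := by ring
    rw [e3, ← volume_setOf_head_mem_Icc _ _ hη.le, ← measure_union']
    · refine (measure_mono ?_).trans hpolevol
      rintro y (⟨h1, h2⟩ | ⟨⟨h1, h2⟩, h3⟩)
      · rw [Set.mem_ofPred_eq, hyw, hs] at h1
        exact ⟨by rw [Set.mem_ofPred_eq]; nlinarith, h2⟩
      · refine ⟨by rw [Set.mem_ofPred_eq]; nlinarith, hinner y ?_ h3⟩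
        rw [abs_of_nonneg (by nlinarith)]
        nlinarith
    · rw [Set.disjoint_left]
      rintro y ⟨h1, -⟩ ⟨⟨-, h2⟩, -⟩
      rw [Set.mem_ofPred_eq, hyw, hs] at h1
      nlinarith
    · exact (measurableSet_le (by fun_prop) (by fun_prop)).inter hK
  have hfin : volume ({y | s ≤ inner ℝ y w} ∩ K) ≠ ⊤ :=
    ((le_self_add.trans hslab).trans_lt ENNReal.ofReal_lt_top).ne
  have hlt : volume ({y | s ≤ inner ℝ y w} ∩ K) + ENNReal.ofReal ((c * τ ^ r / 4) * (2 * η) ^ m) <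
      volume ({y | s ≤ inner ℝ y w} ∩ K) + ENNReal.ofReal (C * β ^ 2) :=
    hslab.trans_lt (hlow.trans_le (hup.trans (by gcongr)))
  have hlt2 := (ENNReal.add_lt_add_iff_left hfin).1 hlt
  have hlt3 : c * τ ^ r / 4 * (2 * η) ^ m < C * β ^ 2 := by
    by_contra! hh
    exact absurd hlt2 (not_lt.2 (ENNReal.ofReal_le_ofReal hh))
  rw [lt_div_iff₀ (by positivity)] at hτ2
  have e4 : C * β ^ 2 = τ ^ r * (4 * C * τ ^ (r - 2)) := by
    rw [hβ, mul_pow, e2]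
    ring
  have e5 : c * τ ^ r / 4 * (2 * η) ^ m = τ ^ r * (c * (2 * η) ^ m / 4) := by ring
  rw [e4, e5, mul_lt_mul_iff_right₀ hr_pos] at hlt3
  have h7 : 0 < τ ^ (r - 2) := by positivity
  nlinarith [le_abs_self C]

/-! ### The balls with exponent larger than two -/

theorem mem_lpUnitBall_iff_sum {n : ℕ} {p : ℝ≥0∞} (hp : 0 < p.toReal)
    {x : EuclideanSpace ℝ (Fin n)} : x ∈ lpUnitBall n p ↔ ∑ i, |x i| ^ p.toReal ≤ 1 := by
  rw [lpUnitBall, Set.mem_ofPred_eq, PiLp.norm_eq_sum hp]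
  simp only [Real.norm_eq_abs]
  have h := Real.rpow_le_rpow_iff (x := ∑ i, |x i| ^ p.toReal) (z := 1 / p.toReal)
    (Finset.sum_nonneg fun i _ => by positivity) zero_le_one (by positivity)
  rwa [Real.one_rpow] at h

theorem mem_lpUnitBall_top_iff {m : ℕ} {x : EuclideanSpace ℝ (Fin (m + 1))} :
    x ∈ lpUnitBall (m + 1) ⊤ ↔ ∀ i, |x i| ≤ 1 := by
  rw [lpUnitBall, Set.mem_ofPred_eq, PiLp.norm_eq_ciSup]
  simp only [Real.norm_eq_abs]
  exact ciSup_le_iff (Set.finite_range _).bddAbove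

theorem measurableSet_lpUnitBall (n : ℕ) {p : ℝ≥0∞} (hp : 1 ≤ p) :
    MeasurableSet (lpUnitBall n p) := by
  have : Fact (1 ≤ p) := ⟨hp⟩
  have h : Continuous fun x : EuclideanSpace ℝ (Fin n) =>
      ‖(WithLp.toLp p (fun i => x i) : PiLp p (fun _ : Fin n => ℝ))‖ :=
    ((PiLp.continuous_toLp p _).comp (by fun_prop)).norm
  exact (isClosed_le h continuous_const).measurableSet

theorem mem_lpUnitBall_iff_add {m : ℕ} {p : ℝ≥0∞} (hp : 0 < p.toReal)
    {x : EuclideanSpace ℝ (Fin (m + 1))} :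
    x ∈ lpUnitBall (m + 1) p ↔ |x 0| ^ p.toReal + ∑ i : Fin m, |x i.succ| ^ p.toReal ≤ 1 := by
  rw [mem_lpUnitBall_iff_sum hp, Fin.sum_univ_succ]

theorem abs_le_one_of_mem_lpUnitBall {n : ℕ} {p : ℝ≥0∞} (hp : 0 < p.toReal)
    {x : EuclideanSpace ℝ (Fin n)} (hx : x ∈ lpUnitBall n p) (i : Fin n) : |x i| ≤ 1 := by
  rw [mem_lpUnitBall_iff_sum hp] at hx
  by_contra! hh
  have h2 := Real.one_lt_rpow hh hp
  have h3 := Finset.single_le_sum (f := fun i => |x i| ^ p.toReal) (fun i _ => by positivity)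
    (Finset.mem_univ i)
  linarith

theorem sum_abs_single_rpow {m : ℕ} {q : ℝ} (hq : 0 < q) (i : Fin m) (τ : ℝ) :
    ∑ j, |(Pi.single i τ : Fin m → ℝ) j| ^ q = |τ| ^ q := by
  rw [Finset.sum_eq_single i]
  · simp
  · intro j _ hj
    simp [hj, hq.ne']
  · simp

/-- The points of a layer below `x₀ = s` that leave the ball under reflection in `s e₀` project to
a shell in the remaining coordinates. -/
theorem lpUnitBall_gain_le {m : ℕ} {p : ℝ≥0∞} (hp : 1 ≤ p.toReal) {s β : ℝ} (hβ : 0 < β)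
    (hsβ : 0 < s - β) (hsβ' : s + β < 1) :
    volume {x : EuclideanSpace ℝ (Fin (m + 1)) | x ∈ lpUnitBall (m + 1) p ∧ s - β ≤ x 0 ∧ x 0 ≤ s ∧
      (2 : ℝ) • consVec s 0 - x ∉ lpUnitBall (m + 1) p} ≤
    ENNReal.ofReal (β * (((1 - (s - β) ^ p.toReal) ^ ((m : ℝ) / p.toReal) -
      (1 - (s + β) ^ p.toReal) ^ ((m : ℝ) / p.toReal)) *
        (volume (Set.univ ∩ {y : Fin m → ℝ | ∑ i, |y i| ^ p.toReal ≤ 1})).toReal)) := by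
  have hp0 : 0 < p.toReal := by linarith
  have h := volume_shell (m := m) hp MeasurableSet.univ (fun _ _ _ _ => Set.mem_univ _) hsβ
    (by linarith : s - β ≤ s + β) hsβ'
  rw [ENNReal.ofReal_mul hβ.le, ← h, show β = s - (s - β) by ring, ← Real.volume_Icc,
    ← volume_setOf_head_mem_tail_mem, show s - (s - β) = β by ring]
  refine measure_mono ?_
  rintro x ⟨hx, h1, h2, h3⟩
  rw [mem_lpUnitBall_iff_add hp0] at hx h3
  refine ⟨⟨h1, h2⟩, Set.mem_univ _, ?_, ?_⟩
  · simp only [PiLp.sub_apply, PiLp.smul_apply, consVec_zero, consVec_succ, smul_eq_mul,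
      Pi.zero_apply, mul_zero, zero_sub, abs_neg, not_le] at h3
    have h4 : |2 * s - x 0| ^ p.toReal ≤ (s + β) ^ p.toReal := by
      refine Real.rpow_le_rpow (abs_nonneg _) ?_ hp0.le
      rw [abs_of_nonneg (by linarith)]
      linarith
    linarith
  · have h4 : (s - β) ^ p.toReal ≤ |x 0| ^ p.toReal :=
      Real.rpow_le_rpow hsβ.le (h1.trans (le_abs_self _)) hp0.le
    linarith

theorem convexFloatingBody_lpUnitBall_ne_of_two_lt {m : ℕ} (hm : 1 ≤ m) {p : ℝ≥0∞}
    (hp : 2 < p.toReal) {δ c : ℝ} (hc0 : 0 < c) (hc1 : c < 1) :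
    convexFloatingBody (lpUnitBall (m + 1) p) δ ≠ c • lpUnitBall (m + 1) p := by
  have hp0 : 0 < p.toReal := by linarith
  have hp1 : 1 ≤ p.toReal := by linarith
  have hp1' : 1 ≤ p := by
    rw [← ENNReal.ofReal_one]
    exact ENNReal.ofReal_le_of_le_toReal hp1
  have hm0 : (0 : ℝ) < m := by exact_mod_cast hm
  obtain ⟨C₁, C₂, -, hC₂, hC⟩ := exists_bounds_one_sub_rpow (e := (m : ℝ) / p.toReal)
    (a := c / 2) (b := (3 + c) / 4) hp1 (by positivity) (by linarith) (by linarith) (by linarith)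
  have hcpow : ((1 + c) / 2) ^ p.toReal < 1 := Real.rpow_lt_one (by linarith) (by linarith) hp0
  set V := (volume (Set.univ ∩ {y : Fin m → ℝ | ∑ i, |y i| ^ p.toReal ≤ 1})).toReal with hV
  have hV0 : 0 ≤ V := ENNReal.toReal_nonneg
  set η := ((1 - ((1 + c) / 2) ^ p.toReal) / m) ^ (1 / p.toReal) with hη
  have hbase : 0 < (1 - ((1 + c) / 2) ^ p.toReal) / m := div_pos (by linarith) hm0
  have hηp : η ^ p.toReal = (1 - ((1 + c) / 2) ^ p.toReal) / m := by
    rw [hη, ← Real.rpow_mul hbase.le, one_div_mul_cancel hp0.ne', Real.rpow_one]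
  refine not_convexFloatingBody_eq_smul_of_flat hm (measurableSet_lpUnitBall _ hp1') (η := η)
    (C := 2 * C₂ * V) (β₀ := min (c / 2) ((1 - c) / 4)) hp hc0 hc1 ?_
    (fun x hx => abs_le_one_of_mem_lpUnitBall hp0 hx) (by positivity) ?_
    (lt_min (by linarith) (by linarith)) ?_
  · intro τ hτ i
    rw [mem_lpUnitBall_iff_add hp0]
    simp only [consVec_zero, consVec_succ]
    rw [sum_abs_single_rpow hp0]
    have h1 : |τ| ^ p.toReal ≤ 1 := Real.rpow_le_one (abs_nonneg _) hτ hp0.le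
    have h2 : 0 ≤ |τ| ^ p.toReal := by positivity
    rw [abs_of_nonneg (by linarith : 0 ≤ 1 - |τ| ^ p.toReal)]
    have h3 := Real.rpow_le_self_of_le_one (by linarith : 0 ≤ 1 - |τ| ^ p.toReal)
      (by linarith) hp1
    linarith
  · intro x hx0 hx
    rw [mem_lpUnitBall_iff_add hp0]
    have h1 : |x 0| ^ p.toReal ≤ ((1 + c) / 2) ^ p.toReal :=
      Real.rpow_le_rpow (abs_nonneg _) hx0 hp0.le
    have h2 : ∑ i : Fin m, |x i.succ| ^ p.toReal ≤ ∑ _i : Fin m, η ^ p.toReal :=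
      Finset.sum_le_sum fun i _ => Real.rpow_le_rpow (abs_nonneg _) (hx i) hp0.le
    rw [Finset.sum_const, Finset.card_univ, Fintype.card_fin, nsmul_eq_mul, hηp,
      mul_div_cancel₀ _ hm0.ne'] at h2
    linarith
  · intro s β h1 h2 h3 h4
    obtain ⟨h5, h6⟩ := le_min_iff.1 h4
    refine (lpUnitBall_gain_le hp1 h3 (by linarith) (by linarith)).trans ?_
    refine ENNReal.ofReal_le_ofReal ?_
    have h7 := (hC (s - β) (s + β) (by linarith) (by linarith) (by linarith)).2
    calc _ ≤ β * ((C₂ * (s + β - (s - β))) * V) := by gcongr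
      _ = 2 * C₂ * V * β ^ 2 := by ring

theorem convexFloatingBody_lpUnitBall_top_ne {m : ℕ} (hm : 1 ≤ m) {δ c : ℝ} (hc0 : 0 < c)
    (hc1 : c < 1) : convexFloatingBody (lpUnitBall (m + 1) ⊤) δ ≠ c • lpUnitBall (m + 1) ⊤ := by
  -- the facet orthogonal to `e₀` is flat to every order, in particular to order `3`
  refine not_convexFloatingBody_eq_smul_of_flat hm (measurableSet_lpUnitBall _ le_top) (r := 3)
    (η := 1) (C := 0) (β₀ := (1 - c) / 4) (by norm_num) hc0 hc1 ?_
    (fun x hx => mem_lpUnitBall_top_iff.1 hx) one_pos ?_ (by linarith) ?_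
  · intro τ hτ i
    rw [mem_lpUnitBall_top_iff]
    intro j
    have h1 : |τ| ^ (3 : ℝ) ≤ 1 := Real.rpow_le_one (abs_nonneg _) hτ (by norm_num)
    have h2 : 0 ≤ |τ| ^ (3 : ℝ) := by positivity
    refine Fin.cases ?_ (fun k => ?_) j
    · rw [consVec_zero, abs_le]
      exact ⟨by linarith, by linarith⟩
    · rw [consVec_succ, Pi.single_apply]
      split_ifs
      · exact hτ
      · simp
  · intro x h0 h1
    rw [mem_lpUnitBall_top_iff]
    intro j
    refine Fin.cases ?_ (fun k => h1 k) j
    linarith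
  · intro s β h1 h2 h3 h4
    have hempty : {x : EuclideanSpace ℝ (Fin (m + 1)) | x ∈ lpUnitBall (m + 1) ⊤ ∧ s - β ≤ x 0 ∧
        x 0 ≤ s ∧ (2 : ℝ) • consVec s 0 - x ∉ lpUnitBall (m + 1) ⊤} = ∅ := by
      refine Set.eq_empty_of_forall_notMem ?_
      rintro x ⟨hx, h5, h6, h7⟩
      rw [mem_lpUnitBall_top_iff] at hx h7
      refine h7 fun j => ?_
      refine Fin.cases ?_ (fun k => ?_) j
      · simp only [PiLp.sub_apply, PiLp.smul_apply, consVec_zero, smul_eq_mul, abs_le]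
        exact ⟨by linarith, by linarith⟩
      · simpa using hx k.succ
    rw [hempty]
    simp

/-! ### The balls with exponent smaller than two -/

/-- The points of the open positive orthant none of whose coordinates is small compared with the
`ℓ_q` norm; the constant `2 m` keeps the diagonal in the interior. -/
def thickCone (m : ℕ) (q : ℝ) : Set (Fin m → ℝ) :=
  {y | ∀ i, 0 < y i ∧ ∑ j, |y j| ^ q ≤ (2 * m * y i) ^ q}

theorem measurableSet_thickCone (m : ℕ) (q : ℝ) : MeasurableSet (thickCone m q) := by
  have h : thickCone m q = ⋂ i : Fin m, {y : Fin m → ℝ | 0 < y i} ∩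
      {y : Fin m → ℝ | ∑ j, |y j| ^ q ≤ (2 * m * y i) ^ q} := by
    ext y
    simp [thickCone]
  rw [h]
  exact MeasurableSet.iInter fun i => (measurableSet_lt (by fun_prop) (by fun_prop)).inter
    (measurableSet_le (by fun_prop) (by fun_prop))

theorem smul_mem_thickCone {m : ℕ} {q : ℝ} (r : ℝ) (hr : 0 < r) (y : Fin m → ℝ)
    (hy : y ∈ thickCone m q) : r • y ∈ thickCone m q := by
  intro i
  obtain ⟨h1, h2⟩ := hy i
  refine ⟨mul_pos hr h1, ?_⟩
  simp only [Pi.smul_apply, smul_eq_mul, abs_mul, abs_of_pos hr]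
  simp only [Real.mul_rpow hr.le (abs_nonneg _)]
  rw [← Finset.mul_sum, show 2 * (m : ℝ) * (r * y i) = r * (2 * m * y i) by ring,
    Real.mul_rpow hr.le (by positivity)]
  gcongr

theorem volume_thickCone_inter_pos {m : ℕ} (hm : 1 ≤ m) {q : ℝ} (hq : 1 ≤ q) :
    0 < volume (thickCone m q ∩ {y | ∑ i, |y i| ^ q ≤ 1}) := by
  have hq0 : 0 < q := by linarith
  have hm0 : (0 : ℝ) < m := by exact_mod_cast hm
  have hm1 : (1 : ℝ) ≤ m := by exact_mod_cast hm
  have hcont : Continuous fun y : Fin m → ℝ => ∑ j, |y j| ^ q :=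
    continuous_finsetSum _ fun j _ => (continuous_apply j).abs.rpow_const fun _ => Or.inr hq0.le
  set U : Set (Fin m → ℝ) := (⋂ i, {y | 0 < y i} ∩ {y | ∑ j, |y j| ^ q < |2 * m * y i| ^ q}) ∩
    {y | ∑ i, |y i| ^ q < 1}
  have hU : IsOpen U := by
    refine (isOpen_iInter_of_finite fun i => ?_).inter (isOpen_lt hcont continuous_const)
    refine (isOpen_lt continuous_const (continuous_apply i)).inter (isOpen_lt hcont ?_)
    exact (continuous_const.mul (continuous_apply i)).abs.rpow_const fun _ => Or.inr hq0.le
  have hsub : U ⊆ thickCone m q ∩ {y | ∑ i, |y i| ^ q ≤ 1} := by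
    rintro y ⟨h1, h2⟩
    refine ⟨fun i => ?_, le_of_lt (Set.mem_ofPred_eq ▸ h2)⟩
    obtain ⟨h3, h4⟩ := Set.mem_iInter.1 h1 i
    rw [Set.mem_ofPred_eq] at h3 h4
    rw [abs_of_pos (by positivity)] at h4
    exact ⟨h3, h4.le⟩
  -- the diagonal point with coordinates `1 / (2 m)`
  have hne : U.Nonempty := by
    have hpos : (0 : ℝ) < 1 / (2 * m) := by positivity
    have h1 : (1 / (2 * (m : ℝ))) ^ q ≤ 1 / (2 * m) := by
      refine Real.rpow_le_self_of_le_one hpos.le ?_ hq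
      rw [div_le_one (by positivity)]
      linarith
    have h2 : ∑ _i : Fin m, |1 / (2 * (m : ℝ))| ^ q < 1 := by
      rw [Finset.sum_const, Finset.card_univ, Fintype.card_fin, nsmul_eq_mul, abs_of_pos hpos]
      calc (m : ℝ) * (1 / (2 * (m : ℝ))) ^ q ≤ m * (1 / (2 * m)) := by gcongr
        _ = 1 / 2 := by field_simp
        _ < 1 := by norm_num
    refine ⟨fun _ => 1 / (2 * m), Set.mem_iInter.2 fun i => ⟨hpos, ?_⟩, h2⟩
    rw [Set.mem_ofPred_eq]
    refine h2.trans_eq ?_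
    rw [mul_one_div_cancel (by positivity), abs_one, Real.one_rpow]
  exact (hU.measure_pos _ hne).trans_le (measure_mono hsub)

/-- The excess of the tilted cap over the polar cap is at least quadratic in the slope. -/
theorem exists_le_volume_gain {m : ℕ} (hm : 1 ≤ m) {p : ℝ≥0∞} (hp : 1 ≤ p.toReal) {c : ℝ}
    (hc0 : 0 < c) (hc1 : c < 1) :
    ∃ C : ℝ, 0 < C ∧ ∀ (s : ℝ) (v : EuclideanSpace ℝ (Fin (m + 1))), c ≤ s → s ≤ (1 + c) / 2 →
      v 0 = 1 → (∀ i : Fin m, 0 ≤ v i.succ) → 0 < ∑ i : Fin m, v i.succ →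
      ∑ i : Fin m, v i.succ ≤ 2 * m →
      ENNReal.ofReal (C * (∑ i : Fin m, v i.succ) ^ 2) ≤
        volume {y | y ∈ lpUnitBall (m + 1) p ∧ inner ℝ y (consVec (m := m) 1 0) ≤ s ∧
          s ≤ inner ℝ y v ∧ (2 : ℝ) • consVec s 0 - y ∉ lpUnitBall (m + 1) p} := by
  have hp0 : 0 < p.toReal := by linarith
  set q := p.toReal with hq
  have hm0 : (0 : ℝ) < m := by exact_mod_cast hm
  obtain ⟨C₁, C₂, hC₁, -, hC⟩ := exists_bounds_one_sub_rpow (e := (m : ℝ) / q)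
    (a := c) (b := (3 + c) / 4) hp (by positivity) hc0 (by linarith) (by linarith)
  have hpow : ((3 + c) / 4) ^ q < 1 := Real.rpow_lt_one (by linarith) (by linarith) hp0
  set r₀ := 1 - ((3 + c) / 4) ^ q with hr₀
  have hr₀0 : 0 < r₀ := by linarith
  set ω := r₀ ^ (1 / q) / (2 * m) with hω
  have hω0 : 0 < ω := by positivity
  have hωq : (2 * m * ω) ^ q = r₀ := by
    rw [hω, mul_div_cancel₀ _ (by positivity), ← Real.rpow_mul hr₀0.le,
      one_div_mul_cancel hp0.ne', Real.rpow_one]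
  set V := (volume (thickCone m q ∩ {y | ∑ i, |y i| ^ q ≤ 1})).toReal with hV
  have hV0 : 0 < V := ENNReal.toReal_pos (volume_thickCone_inter_pos hm hp).ne'
    (volume_sum_rpow_le_one_lt_top hp _).ne
  -- points of the cone in the shell have coordinates at least `ω`, and the thickness of the
  -- layers is `κ` times the slope
  set κ := min ω (min ((1 - c) / (8 * m)) (c / (2 * m))) with hκ
  have hκ0 : 0 < κ := lt_min hω0 (lt_min (div_pos (by linarith) (by positivity)) (by positivity))
  have hκω : κ ≤ ω := min_le_left _ _
  have hκ1 : κ * (2 * m) ≤ (1 - c) / 4 := by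
    have h1 : κ ≤ (1 - c) / (8 * m) := (min_le_right _ _).trans (min_le_left _ _)
    rw [le_div_iff₀ (by positivity)] at h1
    linarith
  have hκ2 : κ * (2 * m) ≤ c := by
    have h1 : κ ≤ c / (2 * m) := (min_le_right _ _).trans (min_le_right _ _)
    rwa [le_div_iff₀ (by positivity)] at h1
  refine ⟨κ / 2 * (C₁ * (κ / 2) * V), by positivity, ?_⟩
  intro s v hs1 hs2 hv0 hv hS0 hS
  set S := ∑ i : Fin m, v i.succ with hSdef
  have hs0 : 0 < s := by linarith
  set h := κ * S with hh
  have hh0 : 0 < h := by positivity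
  have hhκ : h ≤ κ * (2 * m) := by rw [hh]; gcongr
  set Y := thickCone m q ∩ {y | 1 - (s + h / 2) ^ q < ∑ i, |y i| ^ q ∧
    ∑ i, |y i| ^ q ≤ 1 - s ^ q} with hY
  have hYvol := volume_shell (m := m) hp (measurableSet_thickCone m q) smul_mem_thickCone hs0
    (by linarith : s ≤ s + h / 2) (by linarith)
  rw [← hY, ← hV] at hYvol
  have hle : ENNReal.ofReal (κ / 2 * (C₁ * (κ / 2) * V) * S ^ 2) ≤
      volume (Set.Icc (s - h) (s - h / 2)) * volume Y := by
    rw [hYvol, Real.volume_Icc, ← ENNReal.ofReal_mul (by linarith)]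
    refine ENNReal.ofReal_le_ofReal ?_
    have h1 := (hC s (s + h / 2) hs1 (by linarith) (by linarith)).1
    calc κ / 2 * (C₁ * (κ / 2) * V) * S ^ 2
        = (s - h / 2 - (s - h)) * (C₁ * (s + h / 2 - s) * V) := by rw [hh]; ring
      _ ≤ _ := by
        gcongr
        linarith
  refine hle.trans ?_
  rw [← volume_setOf_head_mem_tail_mem]
  refine measure_mono ?_
  rintro y ⟨⟨h1, h2⟩, hyQ, hy1, hy2⟩
  have hy00 : 0 ≤ y 0 := by linarith
  have hcoord : ∀ i : Fin m, ω ≤ y i.succ := fun i => by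
    obtain ⟨h3, h4⟩ := hyQ i
    have h5 : (s + h / 2) ^ q ≤ ((3 + c) / 4) ^ q :=
      Real.rpow_le_rpow (by linarith) (by linarith) hp0.le
    have h6 : (2 * m * ω) ^ q ≤ (2 * m * y i.succ) ^ q := by rw [hωq]; linarith
    have h7 := (Real.rpow_le_rpow_iff (by positivity) (by positivity) hp0).1 h6
    exact le_of_mul_le_mul_left h7 (by positivity)
  refine ⟨?_, ?_, ?_, ?_⟩
  · rw [mem_lpUnitBall_iff_add hp0]
    have h3 : |y 0| ^ q ≤ s ^ q := by
      rw [abs_of_nonneg hy00]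
      exact Real.rpow_le_rpow hy00 (by linarith) hp0.le
    linarith
  · rw [inner_eq_add_sum]
    simp only [consVec_zero, consVec_succ, Pi.zero_apply, mul_zero, Finset.sum_const_zero]
    linarith
  · rw [inner_eq_add_sum, hv0, mul_one]
    have h3 : ω * S ≤ ∑ i : Fin m, y i.succ * v i.succ := by
      rw [hSdef, Finset.mul_sum]
      exact Finset.sum_le_sum fun i _ => mul_le_mul_of_nonneg_right (hcoord i) (hv i)
    have h4 : h ≤ ω * S := by rw [hh]; gcongr
    linarith
  · rw [mem_lpUnitBall_iff_add hp0, not_le]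
    simp only [PiLp.sub_apply, PiLp.smul_apply, consVec_zero, consVec_succ, smul_eq_mul,
      Pi.zero_apply, mul_zero, zero_sub, abs_neg]
    have h3 : (s + h / 2) ^ q ≤ |2 * s - y 0| ^ q := by
      refine Real.rpow_le_rpow (by linarith) ?_ hp0.le
      exact le_trans (by linarith) (le_abs_self _)
    linarith

/-- A supporting hyperplane at the boundary point `(z, τ, …, τ)` of the ball has slopes that are
nonnegative, bounded, and at least of order `τ ^ (p - 1)`. -/
theorem exists_boundary_point_slopes {m : ℕ} (hm : 1 ≤ m) {p : ℝ≥0∞} (hp : 1 ≤ p.toReal)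
    (hp2 : p.toReal < 2) {τ : ℝ} (hτ0 : 0 < τ) (hτ : 2 * m * τ ≤ 1) :
    ∃ x ∈ lpUnitBall (m + 1) p, (∀ r : ℝ, 1 < r → r • x ∉ lpUnitBall (m + 1) p) ∧ x 0 ≤ 1 ∧
      (∀ i : Fin m, x i.succ = τ) ∧
      ∀ u : EuclideanSpace ℝ (Fin (m + 1)), u ≠ 0 →
        (∀ z ∈ lpUnitBall (m + 1) p, inner ℝ z u ≤ inner ℝ x u) →
        0 < u 0 ∧ (∀ i : Fin m, 0 ≤ u i.succ) ∧ ∑ i : Fin m, u i.succ ≤ 2 * m * u 0 ∧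
          τ ^ (p.toReal - 1) / 2 * u 0 ≤ ∑ i : Fin m, u i.succ := by
  have hp0 : 0 < p.toReal := by linarith
  set q := p.toReal with hq
  have hm1 : (1 : ℝ) ≤ m := by exact_mod_cast hm
  have hτ1 : τ ≤ 1 := by nlinarith
  have hτq : τ ^ q ≤ τ := Real.rpow_le_self_of_le_one hτ0.le hτ1 hp
  have hτqpos : 0 < τ ^ q := by positivity
  have hbase : 0 < 1 - m * τ ^ q := by nlinarith
  set z := (1 - m * τ ^ q) ^ (1 / q) with hz
  have hz0 : 0 < z := by positivity
  have hzq : z ^ q = 1 - m * τ ^ q := by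
    rw [hz, ← Real.rpow_mul hbase.le, one_div_mul_cancel hp0.ne', Real.rpow_one]
  have hz1 : z ≤ 1 := Real.rpow_le_one hbase.le (by nlinarith) (by positivity)
  have hz2 : m * τ ^ q / 2 ≤ 1 - z := by
    have h1 : z ^ (2 : ℝ) ≤ z ^ q := Real.rpow_le_rpow_of_exponent_ge hz0 hz1 hp2.le
    rw [Real.rpow_two, hzq] at h1
    nlinarith
  set x : EuclideanSpace ℝ (Fin (m + 1)) := consVec z fun _ => τ with hx
  have hxmem : ∀ y : EuclideanSpace ℝ (Fin (m + 1)), |y 0| = z → (∀ i : Fin m, |y i.succ| = τ) →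
      y ∈ lpUnitBall (m + 1) p := fun y h1 h2 => by
    rw [mem_lpUnitBall_iff_add hp0, h1, hzq]
    simp only [h2, Finset.sum_const, Finset.card_univ, Fintype.card_fin, nsmul_eq_mul]
    linarith
  refine ⟨x, hxmem x (abs_of_pos hz0) fun i => abs_of_pos hτ0, fun r hr hmem => ?_, hz1,
    fun i => rfl, fun u hu hsup => ?_⟩
  · have hr0 : 0 < r := by linarith
    rw [mem_lpUnitBall_iff_add hp0] at hmem
    simp only [PiLp.smul_apply, hx, consVec_zero, consVec_succ, smul_eq_mul, abs_mul,
      abs_of_pos hr0, abs_of_pos hz0, abs_of_pos hτ0, Finset.sum_const, Finset.card_univ,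
      Fintype.card_fin, nsmul_eq_mul] at hmem
    rw [Real.mul_rpow hr0.le hz0.le, Real.mul_rpow hr0.le hτ0.le, hzq] at hmem
    have h1 := Real.one_lt_rpow hr hp0
    nlinarith
  · have hxu : inner ℝ x u = z * u 0 + τ * ∑ i : Fin m, u i.succ := by
      rw [inner_eq_add_sum, Finset.mul_sum]
      rfl
    -- flipping the sign of a coordinate of `x` stays in the ball
    have hnn : ∀ i : Fin m, 0 ≤ u i.succ := fun i => by
      have h1 := hsup (consVec z (Function.update (fun _ => τ) i (-τ)))
        (hxmem _ (abs_of_pos hz0) fun j => by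
          rw [consVec_succ, Function.update_apply]
          split_ifs
          · rw [abs_neg, abs_of_pos hτ0]
          · rw [abs_of_pos hτ0])
      have h2 : ∑ j : Fin m, (Function.update (fun _ => τ) i (-τ) : Fin m → ℝ) j * u j.succ =
          τ * ∑ j : Fin m, u j.succ - 2 * τ * u i.succ := by
        have h3 : ∀ j : Fin m, (Function.update (fun _ => τ) i (-τ) : Fin m → ℝ) j * u j.succ =
            τ * u j.succ - if j = i then 2 * τ * u i.succ else 0 := fun j => by
          rw [Function.update_apply]
          split_ifs with hji
          · subst hji
            ring
          · ring
        simp only [h3, Finset.sum_sub_distrib, Finset.mul_sum, Finset.sum_ite_eq',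
          Finset.mem_univ, if_true]
      rw [hxu, inner_eq_add_sum] at h1
      simp only [consVec_zero, consVec_succ] at h1
      rw [h2] at h1
      have : 0 ≤ τ * u i.succ := by linarith
      exact nonneg_of_mul_nonneg_right this hτ0
    have hpole : u 0 ≤ z * u 0 + τ * ∑ i : Fin m, u i.succ := by
      have h1 := hsup (consVec 1 0) (by
        rw [mem_lpUnitBall_iff_add hp0]
        simp [Real.zero_rpow (show p.toReal ≠ 0 from hp0.ne')])
      rw [hxu, inner_eq_add_sum] at h1
      simpa using h1
    have haxis : ∀ i : Fin m, u i.succ ≤ z * u 0 + τ * ∑ i : Fin m, u i.succ := fun i => by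
      have h1 := hsup (consVec 0 (Pi.single i 1)) (by
        rw [mem_lpUnitBall_iff_add hp0]
        simp only [consVec_zero, consVec_succ]
        rw [sum_abs_single_rpow hp0]
        simp [Real.zero_rpow (show p.toReal ≠ 0 from hp0.ne')])
      rw [hxu, inner_eq_add_sum] at h1
      simpa [Pi.single_apply] using h1
    have hneg : 0 ≤ z * u 0 := by
      have h1 := hsup (consVec (-z) fun _ => τ)
        (hxmem _ (by rw [consVec_zero, abs_neg, abs_of_pos hz0]) fun i => abs_of_pos hτ0)
      rw [hxu, inner_eq_add_sum] at h1
      simp only [consVec_zero, consVec_succ, ← Finset.mul_sum] at h1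
      linarith
    have hu0 : 0 ≤ u 0 := nonneg_of_mul_nonneg_right hneg hz0
    set S := ∑ i : Fin m, u i.succ with hS
    have hS0 : 0 ≤ S := Finset.sum_nonneg fun i _ => hnn i
    have hSle : S ≤ 2 * m * u 0 := by
      have h1 : S ≤ ∑ _i : Fin m, (z * u 0 + τ * S) := Finset.sum_le_sum fun i _ => haxis i
      rw [Finset.sum_const, Finset.card_univ, Fintype.card_fin, nsmul_eq_mul] at h1
      have h2 : m * (τ * S) ≤ S / 2 := by nlinarith
      have h3 : m * (z * u 0) ≤ m * u 0 := by
        gcongr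
        nlinarith
      linarith
    refine ⟨hu0.lt_of_ne fun h0 => hu ?_, hnn, hSle, ?_⟩
    · have hS00 : S = 0 := le_antisymm (by rw [← h0, mul_zero] at hSle; exact hSle) hS0
      ext i
      refine Fin.cases h0.symm (fun j => ?_) i
      exact (Finset.sum_eq_zero_iff_of_nonneg fun i _ => hnn i).1 hS00 j (Finset.mem_univ j)
    · have e1 : τ * τ ^ (q - 1) = τ ^ q := by
        rw [Real.rpow_sub_one hτ0.ne']
        field_simp
      have h1 : m * τ ^ q / 2 * u 0 ≤ τ * S := by nlinarith
      have h2 : τ ^ q / 2 * u 0 ≤ m * τ ^ q / 2 * u 0 := by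
        gcongr
        nlinarith
      refine le_of_mul_le_mul_left ?_ hτ0
      calc τ * (τ ^ (q - 1) / 2 * u 0) = τ ^ q / 2 * u 0 := by rw [← e1]; ring
        _ ≤ τ * S := h2.trans h1

/-- The tangent hyperplane at a point `c (z, τ, …, τ)` near the pole has slopes of total size
`S ≥ τ ^ (p - 1) / 2` and lies only `O(S τ)` further out than the polar one, while tilting enlarges
the cap by at least a multiple of `S ^ 2`; for `p < 2` the second effect dominates. -/
theorem convexFloatingBody_lpUnitBall_ne_of_lt_two {m : ℕ} (hm : 1 ≤ m) {p : ℝ≥0∞}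
    (hp : 1 ≤ p.toReal) (hp2 : p.toReal < 2) {δ c : ℝ} (hc0 : 0 < c) (hc1 : c < 1) :
    convexFloatingBody (lpUnitBall (m + 1) p) δ ≠ c • lpUnitBall (m + 1) p := by
  intro h
  have hp0 : 0 < p.toReal := by linarith
  have hp1' : 1 ≤ p := by
    rw [← ENNReal.ofReal_one]
    exact ENNReal.ofReal_le_of_le_toReal hp
  set K := lpUnitBall (m + 1) p with hKdef
  have hK : MeasurableSet K := measurableSet_lpUnitBall _ hp1'
  have hm0 : (0 : ℝ) < m := by exact_mod_cast hm
  obtain ⟨C, hC, hgain⟩ := exists_le_volume_gain hm hp hc0 hc1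
  obtain ⟨τ, hτ0, hτ1, hτ2⟩ := exists_small_rpow_lt (e := 2 - p.toReal)
    (ε₁ := (1 - c) / (8 * m)) (ε₂ := C / (6 * 2 ^ m)) (by linarith)
    (div_pos (by linarith) (by positivity)) (by positivity)
  rw [lt_div_iff₀ (by positivity)] at hτ1 hτ2
  obtain ⟨x, hxK, hxout, hx0, hxτ, hslope⟩ := exists_boundary_point_slopes hm hp hp2 hτ0
    (by linarith)
  obtain ⟨u, hu0, husup, huvol⟩ := exists_support_volume_cap_le hc0 h hxout
  obtain ⟨hupos, hunn, huS, huS'⟩ := hslope u hu0 husup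
  set v := (u 0)⁻¹ • u with hv
  have hui : 0 < (u 0)⁻¹ := inv_pos.2 hupos
  have hyv : ∀ y : EuclideanSpace ℝ (Fin (m + 1)), inner ℝ y v = (u 0)⁻¹ * inner ℝ y u :=
    fun y => by rw [hv, real_inner_smul_right]
  have hv0 : v 0 = 1 := by simp [hv, hupos.ne']
  have hvnn : ∀ i : Fin m, 0 ≤ v i.succ := fun i => mul_nonneg hui.le (hunn i)
  set S := ∑ i : Fin m, v i.succ with hS
  have hSu : S = (u 0)⁻¹ * ∑ i : Fin m, u i.succ := by
    rw [hS, Finset.mul_sum]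
    rfl
  have hS1 : S ≤ 2 * m := by
    rw [hSu, inv_mul_le_iff₀ hupos]
    linarith
  have hS2 : τ ^ (p.toReal - 1) / 2 ≤ S := by
    rw [hSu, le_inv_mul_iff₀ hupos]
    linarith
  have hS0 : 0 < S := lt_of_lt_of_le (by positivity) hS2
  have hSτ : 0 < S * τ := by positivity
  have hSτ1 : S * τ ≤ (1 - c) / 4 := by nlinarith
  -- the tangent hyperplane lies at height at most `c (1 + S τ)`, strictly below `s`
  set s := c * (1 + 2 * (S * τ)) with hs
  have hcs : c ≤ s := by rw [hs]; nlinarith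
  have hs1 : s ≤ (1 + c) / 2 := by rw [hs]; nlinarith
  set w : EuclideanSpace ℝ (Fin (m + 1)) := consVec 1 0 with hw
  have hyw : ∀ y : EuclideanSpace ℝ (Fin (m + 1)), inner ℝ y w = y 0 := fun y => by
    simp [inner_eq_add_sum, hw]
  have hw0 : w ≠ 0 := fun hh => by
    have := congrArg (fun x : EuclideanSpace ℝ (Fin (m + 1)) => x 0) hh
    simp [hw] at this
  have hwK : w ∈ K := by
    rw [hKdef, mem_lpUnitBall_iff_add hp0]
    simp [hw, hp0.ne']
  have hcap : volume ({y | s ≤ inner ℝ y v} ∩ K) ≤ ENNReal.ofReal δ := by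
    refine (measure_mono (Set.inter_subset_inter_left _ fun y hy => ?_)).trans huvol
    rw [Set.mem_ofPred_eq] at hy ⊢
    have h1 : inner ℝ x v ≤ 1 + S * τ := by
      rw [inner_eq_add_sum, hv0]
      simp only [hxτ, ← Finset.mul_sum]
      linarith
    have h2 : c * inner ℝ x v < inner ℝ y v := by
      refine lt_of_lt_of_le ?_ hy
      rw [hs]
      nlinarith
    rw [hyv, hyv, mul_left_comm, mul_lt_mul_iff_right₀ hui] at h2
    exact h2
  have hcmp := add_le_volume_cap hK (a := consVec s 0) (u := v) (v := w) (s := s)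
    (by rw [inner_eq_add_sum, hv0]; simp) (by rw [hyw]; simp) (fun y hy hys => by
      rw [hyw] at hys
      rw [hKdef, mem_lpUnitBall_iff_add hp0] at hy ⊢
      refine le_trans ?_ hy
      simp only [PiLp.sub_apply, PiLp.smul_apply, consVec_zero, consVec_succ, smul_eq_mul,
        Pi.zero_apply, mul_zero, zero_sub, abs_neg]
      gcongr ?_ ^ _ + _
      rw [abs_of_pos (by linarith : 0 < y 0), abs_le]
      exact ⟨by linarith, by linarith⟩)
  have hgain' := hgain s v hcs hs1 hv0 hvnn hS0 hS1
  have hpolar : ENNReal.ofReal δ ≤ volume ({y | s < inner ℝ y w} ∩ K) +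
      ENNReal.ofReal (3 * c * (S * τ) * 2 ^ m) := by
    have h1 := lt_volume_cap h.ge hw0 hwK (t := c * (1 - S * τ)) (by
      rw [hyw, hw, consVec_zero]
      nlinarith)
    refine h1.le.trans ?_
    have e : 3 * c * (S * τ) * 2 ^ m = (s - c * (1 - S * τ)) * (2 * 1) ^ m := by
      rw [hs]
      ring
    rw [e, ← volume_setOf_head_mem_Icc _ _ zero_le_one]
    refine (measure_mono ?_).trans (measure_union_le _ _)
    rintro y ⟨h2, h3⟩
    rw [Set.mem_ofPred_eq, hyw] at h2
    by_cases hys : s < y 0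
    · exact Or.inl ⟨by rwa [Set.mem_ofPred_eq, hyw], h3⟩
    · exact Or.inr ⟨⟨h2, not_lt.1 hys⟩, fun i => abs_le_one_of_mem_lpUnitBall hp0 h3 _⟩
  set X := volume ({y | s < inner ℝ y w} ∩ K) with hX
  have hXtop : X ≠ ⊤ :=
    ((le_self_add.trans (hcmp.trans hcap)).trans_lt ENNReal.ofReal_lt_top).ne
  have hle : X + ENNReal.ofReal (C * S ^ 2) ≤ X + ENNReal.ofReal (3 * c * (S * τ) * 2 ^ m) :=
    (add_le_add le_rfl hgain').trans (hcmp.trans (hcap.trans hpolar))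
  have hle2 := (ENNReal.ofReal_le_ofReal_iff (by positivity)).1
    ((ENNReal.add_le_add_iff_left hXtop).1 hle)
  have hle3 : C * S ≤ 3 * c * τ * 2 ^ m := by
    refine le_of_mul_le_mul_left ?_ hS0
    linarith
  have e2 : τ ^ (p.toReal - 1) * τ ^ (2 - p.toReal) = τ := by
    rw [← Real.rpow_add hτ0]
    norm_num
  have hT : 0 < τ ^ (p.toReal - 1) := by positivity
  have h2m : (0 : ℝ) < 2 ^ m := by positivity
  have h5 : C * τ ^ (p.toReal - 1) ≤ 6 * 2 ^ m * τ := by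
    have h6 : C * (τ ^ (p.toReal - 1) / 2) ≤ C * S := by gcongr
    have h7 : 3 * c * τ * 2 ^ m ≤ 3 * 1 * τ * 2 ^ m := by gcongr
    linarith
  have h8 : τ ^ (p.toReal - 1) * (τ ^ (2 - p.toReal) * (6 * 2 ^ m)) < τ ^ (p.toReal - 1) * C := by
    gcongr
  rw [← mul_assoc, e2] at h8
  linarith

/-! ### The Euclidean ball -/

theorem lpUnitBall_two (n : ℕ) : lpUnitBall n 2 = Metric.closedBall 0 1 := by
  ext x
  rw [mem_closedBall_zero_iff]
  rfl

theorem volume_cap_closedBall_eq {n : ℕ} {e u : EuclideanSpace ℝ (Fin n)} (h : ‖e‖ = ‖u‖) (t : ℝ) :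
    volume ({y | t ≤ inner ℝ y u} ∩ Metric.closedBall 0 1) =
      volume ({y | t ≤ inner ℝ y e} ∩ Metric.closedBall 0 1) := by
  set R := (ℝ ∙ (e - u))ᗮ.reflection with hR
  have hRe : R e = u := Submodule.reflection_sub h
  have hm := R.measurePreserving.measure_preimage
    (s := {y | t ≤ inner ℝ y u} ∩ Metric.closedBall 0 1)
    (((measurableSet_le (by fun_prop) (by fun_prop)).inter
      measurableSet_closedBall).nullMeasurableSet)
  rw [← hm]
  congr 1
  ext y
  simp only [Set.mem_preimage, Set.mem_inter_iff, Set.mem_ofPred_eq, mem_closedBall_zero_iff,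
    LinearIsometryEquiv.norm_map]
  rw [← hRe, LinearIsometryEquiv.inner_map_map]

theorem exists_pos_lt_volume_cap_closedBall {n : ℕ} {e : EuclideanSpace ℝ (Fin n)} (he : ‖e‖ = 1)
    {δ : ℝ} (hδ0 : 0 ≤ δ)
    (hδ : δ < volume.real (Metric.closedBall (0 : EuclideanSpace ℝ (Fin n)) 1) / 2) :
    ∃ t : ℝ, 0 < t ∧ ENNReal.ofReal δ <
      volume ({y | t ≤ inner ℝ y e} ∩ Metric.closedBall 0 1) := by
  set B := Metric.closedBall (0 : EuclideanSpace ℝ (Fin n)) 1 with hB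
  have hBtop : volume B ≠ ⊤ := measure_closedBall_lt_top.ne
  set P := {y | 0 < inner ℝ y e} ∩ B with hP
  have hPm : MeasurableSet P :=
    (measurableSet_lt (by fun_prop) (by fun_prop)).inter measurableSet_closedBall
  have hhalf : ENNReal.ofReal δ < volume P := by
    have hnull : volume (((ℝ ∙ e)ᗮ : Submodule ℝ (EuclideanSpace ℝ (Fin n))) :
        Set (EuclideanSpace ℝ (Fin n))) = 0 := by
      refine Measure.addHaar_submodule _ _ fun htop => ?_
      have h1 : e ∈ (ℝ ∙ e)ᗮ := htop ▸ Submodule.mem_top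
      rw [Submodule.mem_orthogonal_singleton_iff_inner_right, real_inner_self_eq_norm_sq, he] at h1
      norm_num at h1
    have hneg : volume ((fun y => -y) ⁻¹' P) = volume P :=
      (Measure.measurePreserving_neg volume).measure_preimage hPm.nullMeasurableSet
    have hcover : B ⊆ P ∪ (fun y => -y) ⁻¹' P ∪
        (((ℝ ∙ e)ᗮ : Submodule ℝ (EuclideanSpace ℝ (Fin n))) : Set (EuclideanSpace ℝ (Fin n))) := by
      intro y hy
      rcases lt_trichotomy (inner ℝ y e) 0 with h | h | h
      · refine Or.inl (Or.inr ⟨?_, ?_⟩)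
        · simpa using h
        · simpa [hB] using hy
      · right
        rw [SetLike.mem_coe, Submodule.mem_orthogonal_singleton_iff_inner_left]
        exact h
      · exact Or.inl (Or.inl ⟨h, hy⟩)
    have hle : volume B ≤ 2 * volume P := by
      refine (measure_mono hcover).trans ((measure_union_le _ _).trans ?_)
      rw [hnull, add_zero, two_mul]
      exact (measure_union_le _ _).trans (by rw [hneg])
    have hPtop : volume P ≠ ⊤ := measure_ne_top_of_subset Set.inter_subset_right hBtop
    rw [ENNReal.ofReal_lt_iff_lt_toReal hδ0 hPtop]
    have := ENNReal.toReal_mono (ENNReal.mul_ne_top (by simp) hPtop) hle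
    rw [ENNReal.toReal_mul, ENNReal.toReal_ofNat] at this
    rw [Measure.real] at hδ
    linarith
  set A : ℕ → Set (EuclideanSpace ℝ (Fin n)) := fun k => {y | 1 / ((k : ℝ) + 1) ≤ inner ℝ y e} ∩ B
  have hmono : Monotone A := fun j k hjk => Set.inter_subset_inter_left _ fun y hy =>
    (Nat.one_div_le_one_div (α := ℝ) hjk).trans hy
  have hunion : ⋃ k, A k = P := by
    ext y
    simp only [A, hP, Set.mem_iUnion, Set.mem_inter_iff, Set.mem_ofPred_eq, exists_and_right]
    refine and_congr_left fun _ => ⟨fun ⟨k, hk⟩ => lt_of_lt_of_le (by positivity) hk, fun h => ?_⟩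
    obtain ⟨k, hk⟩ := exists_nat_one_div_lt h
    exact ⟨k, hk.le⟩
  have hlim := tendsto_measure_iUnion_atTop (μ := volume) hmono
  rw [hunion] at hlim
  obtain ⟨k, hk⟩ := (hlim.eventually (lt_mem_nhds hhalf)).exists
  exact ⟨1 / ((k : ℝ) + 1), by positivity, hk⟩

theorem exists_lt_one_volume_cap_closedBall_le {n : ℕ} {e : EuclideanSpace ℝ (Fin n)}
    (he : ‖e‖ = 1) {δ : ℝ} (hδ : 0 < δ) :
    ∃ t : ℝ, t < 1 ∧ volume ({y | t ≤ inner ℝ y e} ∩ Metric.closedBall 0 1) ≤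
      ENNReal.ofReal δ := by
  set B := Metric.closedBall (0 : EuclideanSpace ℝ (Fin n)) 1 with hB
  have hBtop : volume B ≠ ⊤ := measure_closedBall_lt_top.ne
  set A : ℕ → Set (EuclideanSpace ℝ (Fin n)) :=
    fun k => {y | 1 - 1 / ((k : ℝ) + 1) ≤ inner ℝ y e} ∩ B
  have hanti : Antitone A := fun j k hjk => Set.inter_subset_inter_left _ fun y hy =>
    le_trans (sub_le_sub_left (Nat.one_div_le_one_div (α := ℝ) hjk) 1) hy
  have hinter : ⋂ k, A k ⊆ {e} := by
    intro y hy
    have h1 : ∀ k : ℕ, 1 - 1 / ((k : ℝ) + 1) ≤ inner ℝ y e := fun k => (Set.mem_iInter.1 hy k).1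
    have h2 : ‖y‖ ≤ 1 := mem_closedBall_zero_iff.1 (Set.mem_iInter.1 hy 0).2
    have h3 : 1 ≤ inner ℝ y e := by
      have := tendsto_one_div_add_atTop_nhds_zero_nat (𝕜 := ℝ)
      have h4 := (this.const_sub 1)
      rw [sub_zero] at h4
      exact le_of_tendsto' h4 h1
    have h5 := norm_sub_sq_real y e
    rw [he] at h5
    have h6 : ‖y - e‖ ^ 2 ≤ 0 := by nlinarith [norm_nonneg y]
    have h7 : ‖y - e‖ = 0 := by nlinarith [norm_nonneg (y - e)]
    exact sub_eq_zero.1 (norm_eq_zero.1 h7)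
  have : Nontrivial (EuclideanSpace ℝ (Fin n)) :=
    ⟨e, 0, fun h => by rw [h, norm_zero] at he; exact zero_ne_one he⟩
  have hlim := tendsto_measure_iInter_atTop (μ := volume) (s := A)
    (fun k => ((measurableSet_le (by fun_prop) (by fun_prop)).inter
      measurableSet_closedBall).nullMeasurableSet) hanti
    ⟨0, measure_ne_top_of_subset Set.inter_subset_right hBtop⟩
  rw [measure_mono_null hinter (measure_singleton e)] at hlim
  obtain ⟨k, hk⟩ := (hlim.eventually (gt_mem_nhds (ENNReal.ofReal_pos.2 hδ))).exists
  exact ⟨1 - 1 / ((k : ℝ) + 1), sub_lt_self _ (by positivity), hk.le⟩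

/-- By rotation invariance the floating body is the ball whose radius is the infimum of all `t` for
which the cap at height `t` has volume at most `δ`. -/
theorem homotheticToFloatingBody_closedBall {n : ℕ} (hn : 1 ≤ n) {δ : ℝ} (hδ : 0 < δ)
    (hδ' : δ < volume.real (Metric.closedBall (0 : EuclideanSpace ℝ (Fin n)) 1) / 2) :
    HomotheticToFloatingBody (Metric.closedBall (0 : EuclideanSpace ℝ (Fin n)) 1) δ := by
  set e : EuclideanSpace ℝ (Fin n) := EuclideanSpace.single ⟨0, hn⟩ 1
  have he : ‖e‖ = 1 := by simp [e]
  set S : Set ℝ := {t | volume ({y | t ≤ inner ℝ y e} ∩ Metric.closedBall 0 1) ≤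
    ENNReal.ofReal δ} with hS
  obtain ⟨t₀, ht₀, hcap₀⟩ := exists_pos_lt_volume_cap_closedBall he hδ.le hδ'
  obtain ⟨t₁, ht₁, hcap₁⟩ := exists_lt_one_volume_cap_closedBall_le he hδ
  have hlow : ∀ t ∈ S, t₀ ≤ t := fun t ht => by
    by_contra! hlt
    refine absurd (hcap₀.trans_le ((measure_mono ?_).trans ht)) (lt_irrefl _)
    exact Set.inter_subset_inter_left _ fun y hy => hlt.le.trans hy
  have hbdd : BddBelow S := ⟨t₀, hlow⟩
  have hne : S.Nonempty := ⟨t₁, hcap₁⟩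
  have hc0 : 0 < sInf S := ht₀.trans_le (le_csInf hne hlow)
  refine ⟨sInf S, hc0, (csInf_le hbdd hcap₁).trans_lt ht₁, ?_⟩
  rw [smul_unitClosedBall_of_nonneg hc0.le]
  ext x
  simp only [convexFloatingBody, Set.mem_iInter, Set.mem_ofPred_eq, mem_closedBall_zero_iff]
  constructor
  · intro h
    rcases eq_or_ne x 0 with rfl | hx
    · simpa using hc0.le
    · refine le_csInf hne fun t ht => ?_
      have hn0 : ‖x‖ ≠ 0 := norm_ne_zero_iff.2 hx
      have hu : ‖‖x‖⁻¹ • x‖ = 1 := by rw [norm_smul, norm_inv, norm_norm, inv_mul_cancel₀ hn0]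
      have h1 := h (‖x‖⁻¹ • x) t hu
        (by rw [volume_cap_closedBall_eq (he.trans hu.symm)]; exact ht)
      rw [real_inner_smul_right, real_inner_self_eq_norm_sq, sq, inv_mul_cancel_left₀ hn0] at h1
      exact h1
  · intro h u t hu hv
    rw [volume_cap_closedBall_eq (he.trans hu.symm)] at hv
    have h1 := real_inner_le_norm x u
    rw [hu, mul_one] at h1
    exact h1.trans (h.trans (csInf_le hbdd hv))

/-! ### Ellipsoids -/

/-- If an ellipsoid `{x | ‖L x + d‖ ≤ 1}` is the unit ball of the `ℓ_p` norm, then comparing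
antipodal boundary points shows that `‖L x‖` is proportional to this norm. -/
theorem norm_sq_eq_of_norm_add_le_one_iff {n : ℕ} {p : ℝ≥0∞} (hp : 1 ≤ p)
    (L : EuclideanSpace ℝ (Fin n) →ₗ[ℝ] EuclideanSpace ℝ (Fin n)) (d : EuclideanSpace ℝ (Fin n))
    (h : ∀ x, x ∈ lpUnitBall n p ↔ ‖L x + d‖ ≤ 1) {x : EuclideanSpace ℝ (Fin n)} {a : ℝ}
    (ha : 0 < a) (hx : ‖(WithLp.toLp p (fun i => x i) : PiLp p (fun _ : Fin n => ℝ))‖ = a) :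
    ‖L x‖ ^ 2 = (1 - ‖d‖ ^ 2) * a ^ 2 := by
  have : Fact (1 ≤ p) := ⟨hp⟩
  have hsmul : ∀ (r : ℝ) (x : EuclideanSpace ℝ (Fin n)),
      ‖(WithLp.toLp p (fun i => (r • x) i) : PiLp p (fun _ : Fin n => ℝ))‖ =
        |r| * ‖(WithLp.toLp p (fun i => x i) : PiLp p (fun _ : Fin n => ℝ))‖ := fun r x => by
    rw [← Real.norm_eq_abs, ← norm_smul]
    rfl
  have hone : ∀ x : EuclideanSpace ℝ (Fin n),
      ‖(WithLp.toLp p (fun i => x i) : PiLp p (fun _ : Fin n => ℝ))‖ = 1 → ‖L x + d‖ = 1 := by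
    intro x hx
    refine le_antisymm ((h x).1 hx.le) ?_
    have hc : Filter.Tendsto (fun r : ℝ => ‖r • L x + d‖) (nhdsWithin 1 (Set.Ioi 1))
        (nhds ‖L x + d‖) := by
      have h1 : Continuous fun r : ℝ => ‖r • L x + d‖ := by fun_prop
      have h2 := h1.tendsto 1
      rw [one_smul] at h2
      exact h2.mono_left nhdsWithin_le_nhds
    refine ge_of_tendsto hc ?_
    filter_upwards [self_mem_nhdsWithin] with r hr
    have hr1 : (1 : ℝ) < r := hr
    by_contra! hlt
    rw [← map_smul] at hlt
    have h3 : ‖(WithLp.toLp p (fun i => (r • x) i) : PiLp p (fun _ : Fin n => ℝ))‖ ≤ 1 :=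
      (h (r • x)).2 hlt.le
    rw [hsmul, hx, abs_of_pos (by linarith)] at h3
    linarith
  have h1 := hone (a⁻¹ • x) (by rw [hsmul, hx, abs_of_pos (inv_pos.2 ha), inv_mul_cancel₀ ha.ne'])
  have h2 := hone (-a⁻¹ • x) (by
    rw [hsmul, hx, abs_neg, abs_of_pos (inv_pos.2 ha), inv_mul_cancel₀ ha.ne'])
  rw [neg_smul, map_neg] at h2
  rw [map_smul] at h1 h2
  have h3 := norm_add_sq_real (a⁻¹ • L x) d
  have h4 := norm_add_sq_real (-(a⁻¹ • L x)) d
  rw [h1] at h3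
  rw [h2, norm_neg, inner_neg_left] at h4
  have h5 : ‖a⁻¹ • L x‖ ^ 2 = 1 - ‖d‖ ^ 2 := by linarith
  rw [norm_smul, norm_inv, Real.norm_of_nonneg ha.le, mul_pow, inv_pow,
    inv_mul_eq_iff_eq_mul₀ (by positivity)] at h5
  rw [h5, mul_comm]

/-- By the parallelogram law for the vectors `e₀` and `e₁`, an `ℓ_p` ball is an ellipsoid only for
`p = 2`. -/
theorem eq_two_of_isEllipsoid {m : ℕ} (hm : 1 ≤ m) {p : ℝ≥0∞} (hp : 1 ≤ p)
    (h : IsEllipsoid (lpUnitBall (m + 1) p)) : p = 2 := by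
  have : Fact (1 ≤ p) := ⟨hp⟩
  obtain ⟨A, hA⟩ := h
  let i₀ : Fin m := ⟨0, hm⟩
  set L : EuclideanSpace ℝ (Fin (m + 1)) ≃ₗ[ℝ] EuclideanSpace ℝ (Fin (m + 1)) := A.symm.linear
    with hL
  have hmem : ∀ x, x ∈ lpUnitBall (m + 1) p ↔
      ‖(L : EuclideanSpace ℝ (Fin (m + 1)) →ₗ[ℝ] _) x + A.symm 0‖ ≤ 1 := fun x => by
    have h1 : A.symm x = L x + A.symm 0 := by
      have := A.symm.map_vadd 0 x
      simpa [hL] using this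
    rw [LinearEquiv.coe_coe, ← h1, hA]
    constructor
    · rintro ⟨y, hy, rfl⟩
      simpa using hy
    · intro h2
      exact ⟨A.symm x, by simpa using h2, by simp⟩
  have key : ∀ (x : EuclideanSpace ℝ (Fin (m + 1))) (a : ℝ), 0 < a →
      ‖(WithLp.toLp p (fun i => x i) : PiLp p (fun _ : Fin (m + 1) => ℝ))‖ = a →
      ‖L x‖ ^ 2 = (1 - ‖A.symm 0‖ ^ 2) * a ^ 2 :=
    fun x a ha hx => norm_sq_eq_of_norm_add_le_one_iff hp _ _ hmem ha hx
  set e₀ : EuclideanSpace ℝ (Fin (m + 1)) := consVec 1 0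
  set e₁ : EuclideanSpace ℝ (Fin (m + 1)) := consVec 0 (Pi.single i₀ 1)
  have hadd : e₀ + e₁ = consVec 1 (Pi.single i₀ 1) := by
    ext i
    refine Fin.cases ?_ (fun j => ?_) i <;> simp [e₀, e₁]
  have hsub : e₀ - e₁ = consVec 1 (Pi.single i₀ (-1)) := by
    ext i
    refine Fin.cases ?_ (fun j => ?_) i <;> simp [e₀, e₁, Pi.single_neg]
  have main : ∀ ρ : ℝ, 0 < ρ →
      ‖(WithLp.toLp p (fun i => e₀ i) : PiLp p (fun _ : Fin (m + 1) => ℝ))‖ = 1 →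
      ‖(WithLp.toLp p (fun i => e₁ i) : PiLp p (fun _ : Fin (m + 1) => ℝ))‖ = 1 →
      ‖(WithLp.toLp p (fun i => (e₀ + e₁) i) : PiLp p (fun _ : Fin (m + 1) => ℝ))‖ = ρ →
      ‖(WithLp.toLp p (fun i => (e₀ - e₁) i) : PiLp p (fun _ : Fin (m + 1) => ℝ))‖ = ρ →
      ρ ^ 2 = 2 := by
    intro ρ hρ h1 h2 h3 h4
    have k1 := key _ 1 one_pos h1
    have k2 := key _ 1 one_pos h2
    have k3 := key _ ρ hρ h3
    have k4 := key _ ρ hρ h4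
    have k5 := parallelogram_law_with_norm ℝ (L e₀) (L e₁)
    rw [← map_add, ← map_sub] at k5
    have hpos : 0 < ‖L e₀‖ := by
      rw [norm_pos_iff]
      intro h0
      have h5 := congrArg (fun x : EuclideanSpace ℝ (Fin (m + 1)) => x 0)
        (L.map_eq_zero_iff.1 h0)
      simp [e₀] at h5
    have hpos2 : 0 < 1 - ‖A.symm 0‖ ^ 2 := by nlinarith [sq_pos_of_pos hpos]
    have k6 : (1 - ‖A.symm 0‖ ^ 2) * ρ ^ 2 = (1 - ‖A.symm 0‖ ^ 2) * 2 := by nlinarith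
    exact mul_left_cancel₀ hpos2.ne' k6
  rcases eq_or_ne p ⊤ with rfl | htop
  · exfalso
    have hnorm : ∀ x : EuclideanSpace ℝ (Fin (m + 1)), x 0 = 1 ∨ x i₀.succ = 1 → (∀ i, |x i| ≤ 1) →
        ‖(WithLp.toLp ⊤ (fun i => x i) : PiLp ⊤ (fun _ : Fin (m + 1) => ℝ))‖ = 1 := by
      intro x hx hx1
      refine le_antisymm (mem_lpUnitBall_top_iff.2 hx1) ?_
      rcases hx with hx | hx
      · have := PiLp.norm_apply_le
          (WithLp.toLp ⊤ (fun i => x i) : PiLp ⊤ (fun _ : Fin (m + 1) => ℝ)) 0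
        simpa [hx] using this
      · have := PiLp.norm_apply_le
          (WithLp.toLp ⊤ (fun i => x i) : PiLp ⊤ (fun _ : Fin (m + 1) => ℝ)) i₀.succ
        simpa [hx] using this
    have hbd : ∀ a b : ℝ, |a| ≤ 1 → |b| ≤ 1 → ∀ i, |consVec a (Pi.single i₀ b) i| ≤ 1 := by
      intro a b ha hb i
      refine Fin.cases ha (fun j => ?_) i
      rw [consVec_succ, Pi.single_apply]
      split_ifs
      · exact hb
      · simp
    have h0 : e₀ = consVec 1 (Pi.single i₀ 0) := by simp [e₀]
    have := main 1 one_pos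
      (hnorm _ (Or.inl rfl) (by rw [h0]; exact hbd 1 0 (by simp) (by simp)))
      (hnorm _ (Or.inr (by simp [e₁])) (hbd 0 1 (by simp) (by simp)))
      (hnorm _ (Or.inl (by rw [hadd]; rfl)) (by rw [hadd]; exact hbd 1 1 (by simp) (by simp)))
      (hnorm _ (Or.inl (by rw [hsub]; rfl)) (by rw [hsub]; exact hbd 1 (-1) (by simp) (by simp)))
    norm_num at this
  · have hq1 : 1 ≤ p.toReal := by
      rw [← ENNReal.toReal_one]
      exact ENNReal.toReal_mono htop hp
    have hq0 : 0 < p.toReal := by linarith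
    have hnorm : ∀ a b : ℝ, ‖(WithLp.toLp p (fun i => consVec a (Pi.single i₀ b) i) :
        PiLp p (fun _ : Fin (m + 1) => ℝ))‖ =
          (|a| ^ p.toReal + |b| ^ p.toReal) ^ (1 / p.toReal) := by
      intro a b
      rw [PiLp.norm_eq_sum hq0]
      simp only [Real.norm_eq_abs]
      rw [Fin.sum_univ_succ]
      simp only [consVec_zero, consVec_succ]
      rw [sum_abs_single_rpow hq0]
    have h0 : e₀ = consVec 1 (Pi.single i₀ 0) := by simp [e₀]
    have h2 := main (2 ^ (1 / p.toReal)) (by positivity)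
      (by rw [h0, hnorm]; simp [hq0.ne']) (by rw [hnorm]; simp [hq0.ne'])
      (by rw [hadd, hnorm]; norm_num) (by rw [hsub, hnorm]; norm_num)
    rw [← Real.rpow_natCast, ← Real.rpow_mul zero_le_two] at h2
    have h3 : 1 / p.toReal * ((2 : ℕ) : ℝ) = 1 := by
      have h4 := congrArg Real.log h2
      rw [Real.log_rpow two_pos] at h4
      exact mul_right_cancel₀ (Real.log_pos one_lt_two).ne' (h4.trans (one_mul _).symm)
    have h5 : p.toReal = 2 := by
      field_simp at h3
      push_cast at h3
      linarith
    rw [← ENNReal.ofReal_toReal htop, h5]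
    simp

/-! ### Floating bodies of the `ℓ_p` balls and their linear images -/

theorem homotheticToFloatingBody_lpUnitBall_iff {m : ℕ} (hm : 1 ≤ m) {p : ℝ≥0∞} (hp : 1 ≤ p) {δ : ℝ}
    (hδ : 0 < δ) (hδ' : δ < volume.real (lpUnitBall (m + 1) p) / 2) :
    HomotheticToFloatingBody (lpUnitBall (m + 1) p) δ ↔ p = 2 := by
  constructor
  · rintro ⟨c, hc0, hc1, h⟩
    rcases eq_or_ne p ⊤ with rfl | htop
    · exact absurd h (convexFloatingBody_lpUnitBall_top_ne hm hc0 hc1)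
    have hq1 : 1 ≤ p.toReal := by
      rw [← ENNReal.toReal_one]
      exact ENNReal.toReal_mono htop hp
    rcases lt_trichotomy p.toReal 2 with hlt | heq | hgt
    · exact absurd h (convexFloatingBody_lpUnitBall_ne_of_lt_two hm hq1 hlt hc0 hc1)
    · rw [← ENNReal.ofReal_toReal htop, heq]
      simp
    · exact absurd h (convexFloatingBody_lpUnitBall_ne_of_two_lt hm hgt hc0 hc1)
  · rintro rfl
    rw [lpUnitBall_two] at hδ' ⊢
    exact homotheticToFloatingBody_closedBall (by omega) hδ hδ'

theorem isEllipsoid_image_lpUnitBall_iff {m : ℕ} (hm : 1 ≤ m) {p : ℝ≥0∞} (hp : 1 ≤ p)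
    (T : EuclideanSpace ℝ (Fin (m + 1)) ≃ₗ[ℝ] EuclideanSpace ℝ (Fin (m + 1))) :
    IsEllipsoid (T '' lpUnitBall (m + 1) p) ↔ p = 2 := by
  constructor
  · rintro ⟨A, hA⟩
    refine eq_two_of_isEllipsoid hm hp ⟨A.trans T.symm.toAffineEquiv, ?_⟩
    have h := congrArg (fun S => T.symm '' S) hA
    simp only [Set.image_image, LinearEquiv.symm_apply_apply, Set.image_id'] at h
    rw [h]
    rfl
  · rintro rfl
    exact ⟨T.toAffineEquiv, by rw [lpUnitBall_two]; rfl⟩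

theorem mainTheorem2 (n : ℕ) (hn : 2 ≤ n) (p : ℝ≥0∞) (hp : 1 ≤ p) :
    (∀ δ : ℝ, 0 < δ → δ < volume.real (lpUnitBall n p) / 2 →
      (HomotheticToFloatingBody (lpUnitBall n p) δ ↔ p = 2)) ∧
    (∀ (T : EuclideanSpace ℝ (Fin n) ≃ₗ[ℝ] EuclideanSpace ℝ (Fin n)) (δ : ℝ),
      0 < δ → δ < volume.real (T '' lpUnitBall n p) / 2 →
      (HomotheticToFloatingBody (T '' lpUnitBall n p) δ ↔ p = 2) ∧
      (HomotheticToFloatingBody (T '' lpUnitBall n p) δ ↔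
        IsEllipsoid (T '' lpUnitBall n p))) := by
  obtain ⟨m, rfl⟩ : ∃ m, n = m + 1 := ⟨n - 1, by omega⟩
  have hm : 1 ≤ m := by omega
  refine ⟨fun δ hδ hδ' => homotheticToFloatingBody_lpUnitBall_iff hm hp hδ hδ',
    fun T δ hδ hδ' => ?_⟩
  have hT : HomotheticToFloatingBody (T '' lpUnitBall (m + 1) p) δ ↔ p = 2 := by
    rw [homotheticToFloatingBody_image]
    set D := |LinearMap.det (T : EuclideanSpace ℝ (Fin (m + 1)) →ₗ[ℝ] _)| with hD
    have hD0 : 0 < D := abs_pos.2 (LinearEquiv.isUnit_det' T).ne_zero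
    refine homotheticToFloatingBody_lpUnitBall_iff hm hp (by positivity) ?_
    have hvol : volume.real (T '' lpUnitBall (m + 1) p) =
        D * volume.real (lpUnitBall (m + 1) p) := by
      have h := Measure.addHaar_image_linearMap (volume : Measure (EuclideanSpace ℝ (Fin (m + 1))))
        (T : EuclideanSpace ℝ (Fin (m + 1)) →ₗ[ℝ] _) (lpUnitBall (m + 1) p)
      rw [Measure.real, Measure.real, hD]
      rw [LinearEquiv.coe_coe] at h
      rw [h, ENNReal.toReal_mul, ENNReal.toReal_ofReal (abs_nonneg _)]
    rw [hvol] at hδ'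
    rw [div_lt_iff₀ hD0]
    linarith
  exact ⟨hT, hT.trans (isEllipsoid_image_lpUnitBall_iff hm hp T).symm⟩
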